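/- **Setting.** A *hypersurface* is a compact oriented topological 1-manifold, a *region* a compact oriented topological surface, both possibly empty or with boundary; a bar denotes orientation reversal. A *gluing function* is a continuous, closed, surjective, orientation-preserving map that restricts to an embedding of the manifold interior. A *slice region* for a hypersurface $\Sigma$ is a region $S$ with a gluing function $s:\overline\Sigma\sqcup\Sigma\to\partial S$ such that $S$ is the cylinder $\Sigma\times[0,1]$ pinched along $\partial\Sigma$ and $s$ is given by its two faces. A *relative gluing diagram* consists of gluing functions $\alpha:\Sigma\sqcup\overline\Sigma\sqcup\Lambda\to\partial X$, $f:X\to X'$, $\beta:\Lambda\to\partial X'$ such that $f$ is the coequalizer of the two maps $\Sigma\rightrightarrows X$ induced by $\alpha$, and $f\circ\alpha|_\Lambda=\beta$. Regions and relative gluing diagrams may be restricted to an *admissible* class, closed under $\sqcup$ and orientation reversal, containing $\emptyset$, the regions of admissible diagrams, and a slice region for every hypersurface. A 2-dimensional *CQFT* assigns: to every hypersurface $\Sigma$ a complex Krein superspace $\mathcal H_\Sigma$ (with inner product $\langle\cdot,\cdot\rangle_\Sigma$, antilinear in the first argument, possibly indefinite, for which the even and odd parts are orthogonal) with a dense subspace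 $\mathcal H_\Sigma^\circ$, where $\mathcal H_\emptyset=\mathbb C$; antilinear graded isomorphisms $\iota_\Sigma:\mathcal H_\Sigma\to\mathcal H_{\overline\Sigma}$ with $\iota_{\overline\Sigma}\iota_\Sigma=\mathrm{id}$; graded isomorphisms $\tau:\mathcal H_{\Sigma_1}\hat\otimes\mathcal H_{\Sigma_2}\to\mathcal H_{\Sigma_1\sqcup\Sigma_2}$; to every gluing function $f:\Sigma\to\Sigma'$ a graded epimorphism $\gamma_f:\mathcal H_\Sigma\to\mathcal H_{\Sigma'}$, bijective if $f$ is a homeomorphism, with $\gamma_{\mathrm{id}}=\mathrm{id}$; all these preserve the dense subspaces; and to every admissible region $X$ a graded linear map $\rho_X:\mathcal H_{\partial X}^\circ\to\mathbb C$ with $\rho_\emptyset=\mathrm{id}$. These satisfy: $\tau$ is associative; $\gamma$ respects commuting squares; $\tau(\iota v\otimes\iota w)=\iota\,\tau(w\otimes v)$; $\gamma_{f\sqcup g}\tau=\tau(\gamma_f\otimes\gamma_g)$; $\iota\gamma_f=\gamma_{\overline f}\iota$; $\rho_{X\sqcup Y}(\tau(v\otimes w))=\rho_X(v)\rho_Y(w)$;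 $\rho_{\overline X}(\iota v)=\overline{\rho_X(v)}$; $\rho_{X'}\circ\gamma_{f|_{\partial X}}=\rho_X$ for homeomorphisms $f:X\to X'$; for every admissible slice region $(S,s)$ of $\Sigma$, $\gamma_s\tau(\mathcal H_{\overline\Sigma}\times\mathcal H_\Sigma)\subseteq\mathcal H_{\partial S}^\circ$ and $\langle v,w\rangle_\Sigma=\rho_S(\gamma_s\tau(\iota_\Sigma v\otimes w))$; and for every admissible relative gluing diagram, $\gamma_\alpha\tau(\zeta\otimes\iota\zeta\otimes v)\in\mathcal H_{\partial X}^\circ$ for $\zeta\in\mathcal H_\Sigma$, $v\in\mathcal H_\Lambda^\circ$, and $\rho_{X'}(\gamma_\beta v)=c\sum_k(-1)^{[\zeta_k]}\rho_X(\gamma_\alpha\tau(\zeta_k\otimes\iota\zeta_k\otimes v))$ for every orthonormal basis $(\zeta_k)$ of $\mathcal H_\Sigma$, with a constant $c\neq0$ depending only on the diagram and equal to $1$ for homeomorphisms. The CQFT is *symmetric* if $\tau(v\otimes w)=(-1)^{|v||w|}\tau(w\otimes v)$ for homogeneous $v,w$, where $\Sigma_1\sqcup\Sigma_2=\Sigma_2\sqcup\Sigma_1$.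 Let $I=[0,1]$, let $D$ be the closed unit disk, $C=\partial D$. Fix gluing functions $f_{I\sqcup I,I}:I\sqcup I\to I$, $f_{I,C}:I\to C$, $f_{I,\overline I}:I\to\overline I$, $f_{C,\overline C}:C\to\overline C$, $f_\pi:C\to C$, $f_{D,\overline D}:D\to\overline D$ such that, as maps of points, $f_{I,\overline I}$, $f_{C,\overline C}$, $f_\pi$, $f_{D,\overline D}$ are involutions, $f_{I,\overline I}\circ f_{I\sqcup I,I}=f_{I\sqcup I,I}\circ\sigma\circ(f_{I,\overline I}\sqcup f_{I,\overline I})$ with $\sigma$ the exchange of the two copies of $I$, $f_{C,\overline C}\circ f_{I,C}=f_{I,C}\circ f_{I,\overline I}$, $f_\pi\circ f_{I,C}\circ f_{I\sqcup I,I}=f_{I,C}\circ f_{I\sqcup I,I}\circ\sigma$, $f_\pi\circ f_{C,\overline C}=f_{C,\overline C}\circ f_\pi$, and $f_{D,\overline D}|_C=f_{C,\overline C}$. Write $\gamma_{I\sqcup I,I}$ (with $\tau$ implicit), $\gamma_{I,C}$, $\gamma_{I,\overline I}$ for the associated maps and $\alpha_I=\iota_{\overline I}\circ\gamma_{I,\overline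 I}:\mathcal H_I\to\mathcal H_I$. For a Krein superspace $\mathcal H=\mathcal H^0\oplus\mathcal H^1$, a *fundamental decomposition* is a decomposition $\mathcal H^i=\mathcal H^{i,+}\oplus\mathcal H^{i,-}$ ($i=0,1$) into orthogonal closed subspaces that are Hilbert spaces for $\pm\langle\cdot,\cdot\rangle$. An *orthonormal basis adapted to it* is a family $(\zeta_k)$ that is the union of orthonormal bases of the four subspaces (with respect to $\pm\langle\cdot,\cdot\rangle$); $|\zeta_k|\in\mathbb Z/2$ is the degree of $\zeta_k$, and $[\zeta_k]\in\mathbb Z/2$ is $0$ or $1$ according to the sign of the subspace. **Proposition.** Let a symmetric 2-dimensional CQFT be given for which $D$ is admissible. 1. For all $\psi,\eta\in\mathcal H_I$ the vector $\gamma_{I,C}(\gamma_{I\sqcup I,I}(\alpha_I(\psi)\otimes\eta))$ lies in $\mathcal H_C^\circ$, and $$\langle\psi,\eta\rangle_I=\rho_D\bigl(\gamma_{I,C}(\gamma_{I\sqcup I,I}(\alpha_I(\psi)\otimes\eta))\bigr).$$ 2. For all homogeneous $\psi,\eta\in\mathcal H_I$, $$\langle\alpha_I(\psi),\alpha_I(\eta)\rangle_I=(-1)^{|\psi||\eta|}\langle\eta,\psi\rangle_I=(-1)^{|\psi||\eta|}\,\overline{\langle\psi,\eta\rangle_I}.$$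 3. The image under $\alpha_I$ of any fundamental decomposition of $\mathcal H_I$ is again one, where $\alpha_I(\mathcal H_I^{0,\pm})$ are the subspaces of degree $0$ and sign $\pm$, and $\alpha_I(\mathcal H_I^{1,\pm})$ those of degree $1$ and sign $\mp$. If $(\zeta_k)$ is an orthonormal basis adapted to the first decomposition, then $(\alpha_I(\zeta_k))$ is an orthonormal basis adapted to the second, with $|\alpha_I(\zeta_k)|=|\zeta_k|$ and $[\alpha_I(\zeta_k)]=[\zeta_k]+|\zeta_k|$. 4. There is a fundamental decomposition of $\mathcal H_I$ with $\alpha_I(\mathcal H_I^{0,\pm})=\mathcal H_I^{0,\pm}$ and $\alpha_I(\mathcal H_I^{1,\pm})=\mathcal H_I^{1,\mp}$. -/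

import Mathlib

open Topology Filter
open scoped unitInterval TensorProduct ComplexConjugate

universe u

namespace CQFT

/-! ## Charts -/

/-- A chart of a space `M` with values in a model space `E`: an open embedding into `E` of an open
subset `source` of `M`. The values of `toFun` outside `source` carry no information. -/
structure LocalChart (M E : Type) [TopologicalSpace M] [TopologicalSpace E] where
  source : Set M
  toFun : M → E
  open_source : IsOpen source
  isOpenEmbedding : IsOpenEmbedding (fun x : source => toFun x)

namespace LocalChart

variable {M N E F : Type} [TopologicalSpace M] [TopologicalSpace N] [TopologicalSpace E]
  [TopologicalSpace F]

/-- Transport of a chart along an open embedding `j`; `g` is the transported function, extended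
arbitrarily outside the range of `j`. -/
def push (e : LocalChart M E) (j : M → N) (hj : IsOpenEmbedding j) (g : N → E)
    (hg : ∀ x, g (j x) = e.toFun x) : LocalChart N E where
  source := j '' e.source
  toFun := g
  open_source := hj.isOpenMap _ e.open_source
  isOpenEmbedding := by
    have h : (fun y : j '' e.source => g y) =
        (fun x : e.source => e.toFun x) ∘ (hj.isEmbedding.homeomorphImage e.source).symm := by
      funext y
      obtain ⟨x, rfl⟩ := (hj.isEmbedding.homeomorphImage e.source).surjective y
      simp only [Function.comp, Homeomorph.symm_apply_apply]
      exact hg x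
    rw [h]
    exact e.isOpenEmbedding.comp (Homeomorph.isOpenEmbedding _)

/-- Composition of a chart with a homeomorphism of the model space. -/
def post (e : LocalChart M E) (h : E ≃ₜ F) : LocalChart M F where
  source := e.source
  toFun := fun x => h (e.toFun x)
  open_source := e.open_source
  isOpenEmbedding := h.isOpenEmbedding.comp e.isOpenEmbedding

/-- A chart of `M`, as a chart of the left summand of `M ⊕ N` (`d` is a dummy value). -/
def inl (d : E) (e : LocalChart M E) : LocalChart (M ⊕ N) E :=
  e.push Sum.inl IsOpenEmbedding.inl (Sum.elim e.toFun fun _ => d) fun _ => rfl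

/-- A chart of `N`, as a chart of the right summand of `M ⊕ N` (`d` is a dummy value). -/
def inr (d : E) (e : LocalChart N E) : LocalChart (M ⊕ N) E :=
  e.push Sum.inr IsOpenEmbedding.inr (Sum.elim (fun _ => d) e.toFun) fun _ => rfl

end LocalChart

lemma isEmbedding_sumMap_aux {M N M' N' : Type} [TopologicalSpace M] [TopologicalSpace N]
    [TopologicalSpace M'] [TopologicalSpace N'] {f : M → M'} {g : N → N'}
    (hf : IsEmbedding f) (hg : IsEmbedding g) : IsEmbedding (Sum.map f g) := by
  refine (IsEmbedding.inl.comp hf).sumElim_of_separatedNhds (IsEmbedding.inr.comp hg) ?_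
  refine ⟨Set.range Sum.inl, Set.range Sum.inr, isOpen_range_inl, isOpen_range_inr, ?_, ?_,
    Set.isCompl_range_inl_range_inr.disjoint⟩
  · exact Set.range_comp_subset_range _ _
  · exact Set.range_comp_subset_range _ _

lemma isEmbedding_sumMap {M N M' N' : Type} [TopologicalSpace M] [TopologicalSpace N]
    [TopologicalSpace M'] [TopologicalSpace N'] {f : M → M'} {g : N → N'} {s : Set M} {t : Set N}
    {r : Set (M ⊕ N)} (hf : IsEmbedding fun x : s => f x) (hg : IsEmbedding fun x : t => g x)
    (hs : ∀ x, Sum.inl x ∈ r ↔ x ∈ s) (ht : ∀ x, Sum.inr x ∈ r ↔ x ∈ t) :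
    IsEmbedding fun x : r => Sum.map f g x := by
  have hval : IsEmbedding (Sum.map Subtype.val Subtype.val : s ⊕ t → M ⊕ N) :=
    isEmbedding_sumMap_aux IsEmbedding.subtypeVal IsEmbedding.subtypeVal
  have hmem : ∀ x : s ⊕ t, Sum.map Subtype.val Subtype.val x ∈ r := by
    rintro (⟨x, hx⟩ | ⟨x, hx⟩)
    · exact (hs x).2 hx
    · exact (ht x).2 hx
  let φ : s ⊕ t → r := fun x => ⟨_, hmem x⟩
  have hφ : IsEmbedding φ := hval.codRestrict r hmem
  have hsurj : Function.Surjective φ := by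
    rintro ⟨x | x, hx⟩
    · exact ⟨Sum.inl ⟨x, (hs x).1 hx⟩, rfl⟩
    · exact ⟨Sum.inr ⟨x, (ht x).1 hx⟩, rfl⟩
  let Φ : s ⊕ t ≃ₜ r := hφ.toHomeomorphOfSurjective hsurj
  have h := (isEmbedding_sumMap_aux hf hg).comp Φ.symm.isEmbedding
  convert h using 1
  funext y
  obtain ⟨x, rfl⟩ := Φ.surjective y
  simp only [Function.comp, Homeomorph.symm_apply_apply]
  rcases x with x | x <;> rfl

/-! ## Hypersurfaces: compact oriented topological 1-manifolds with boundary -/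

/-- The real functions `u` and `v` order the points near `x` in the same way: if `u` and `v` are
coordinates, the change of coordinates is increasing near `x`. -/
def SameOrderAt {M : Type} [TopologicalSpace M] (u v : M → I) (x : M) : Prop :=
  ∀ᶠ p in 𝓝 (x, x), u p.1 < u p.2 ↔ v p.1 < v p.2

namespace SameOrderAt

variable {M N : Type} [TopologicalSpace M] [TopologicalSpace N]

lemma sigma {u v : M → I} {x : M} (h : SameOrderAt u v x) :
    SameOrderAt (fun y => unitInterval.symm (u y)) (fun y => unitInterval.symm (v y)) x := by
  have hs : Tendsto (Prod.swap : M × M → M × M) (𝓝 (x, x)) (𝓝 (x, x)) :=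
    continuous_swap.tendsto' _ _ rfl
  filter_upwards [hs.eventually h] with p hp
  simpa using hp

lemma comp {u v : N → I} {x : M} {j : M → N} (hj : ContinuousAt j x)
    (h : SameOrderAt u v (j x)) : SameOrderAt (fun y => u (j y)) (fun y => v (j y)) x := by
  have : Tendsto (Prod.map j j) (𝓝 (x, x)) (𝓝 (j x, j x)) := by
    rw [nhds_prod_eq, nhds_prod_eq]; exact hj.tendsto.prodMap hj.tendsto
  exact this.eventually h

lemma of_comp {u v : N → I} {x : M} {j : M → N} (hj : IsOpenEmbedding j)
    (h : SameOrderAt (fun y => u (j y)) (fun y => v (j y)) x) : SameOrderAt u v (j x) := by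
  have h2 := (hj.prodMap hj).map_nhds_eq (x, x)
  unfold SameOrderAt
  rw [show ((j x, j x) : N × N) = Prod.map j j (x, x) from rfl, ← h2]
  exact h

lemma trans {u v w : M → I} {x : M} (h : SameOrderAt u v x) (h' : SameOrderAt v w x) :
    SameOrderAt u w x := by
  filter_upwards [h, h'] with p hp hp'
  exact hp.trans hp'

lemma of_eqOn {u v : M → I} {x : M} {s : Set M} (hs : IsOpen s) (hx : x ∈ s)
    (h : ∀ y ∈ s, u y = v y) : SameOrderAt u v x := by
  filter_upwards [(hs.prod hs).mem_nhds (show (x, x) ∈ s ×ˢ s from ⟨hx, hx⟩)] with p hp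
  rw [h _ hp.1, h _ hp.2]

end SameOrderAt

/-- A hypersurface: a compact Hausdorff space with an oriented atlas modelled on open subsets of
the interval `[0,1]`, that is, a compact oriented topological 1-manifold with (possibly empty)
boundary. -/
structure Hypersurface where
  carrier : Type
  [topology : TopologicalSpace carrier]
  [compact : CompactSpace carrier]
  [hausdorff : T2Space carrier]
  charts : Set (LocalChart carrier I)
  cover : ∀ x, ∃ e ∈ charts, x ∈ e.source
  compat : ∀ e ∈ charts, ∀ e' ∈ charts, ∀ x, x ∈ e.source → x ∈ e'.source →
    SameOrderAt e.toFun e'.toFun x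

attribute [instance] Hypersurface.topology Hypersurface.compact Hypersurface.hausdorff

namespace Hypersurface

/-- The manifold interior. -/
def interior (M : Hypersurface) : Set M.carrier :=
  {x | ∃ e ∈ M.charts, x ∈ e.source ∧ 0 < e.toFun x ∧ e.toFun x < 1}

/-- Orientation reversal. -/
def rev (M : Hypersurface) : Hypersurface where
  carrier := M.carrier
  charts := {e | ∃ e₀ ∈ M.charts, e = e₀.post unitInterval.symmHomeomorph}
  cover x := by
    obtain ⟨e, he, hx⟩ := M.cover x
    exact ⟨_, ⟨e, he, rfl⟩, hx⟩
  compat := by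
    rintro _ ⟨e, he, rfl⟩ _ ⟨e', he', rfl⟩ x hx hx'
    exact SameOrderAt.sigma (M.compat e he e' he' x hx hx')

/-- Disjoint union. -/
def sum (M N : Hypersurface) : Hypersurface where
  carrier := M.carrier ⊕ N.carrier
  charts := {e | (∃ e₀ ∈ M.charts, e = e₀.inl 0) ∨ ∃ e₀ ∈ N.charts, e = e₀.inr 0}
  cover := by
    rintro (x | x)
    · obtain ⟨e, he, hx⟩ := M.cover x
      exact ⟨_, Or.inl ⟨e, he, rfl⟩, x, hx, rfl⟩
    · obtain ⟨e, he, hx⟩ := N.cover x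
      exact ⟨_, Or.inr ⟨e, he, rfl⟩, x, hx, rfl⟩
  compat := by
    rintro _ (⟨e, he, rfl⟩ | ⟨e, he, rfl⟩) _ (⟨e', he', rfl⟩ | ⟨e', he', rfl⟩) _
      ⟨x, hx, rfl⟩ ⟨y, hy, hxy⟩
    · obtain rfl := Sum.inl_injective hxy
      exact SameOrderAt.of_comp IsOpenEmbedding.inl (M.compat e he e' he' _ hx hy)
    · simp at hxy
    · simp at hxy
    · obtain rfl := Sum.inr_injective hxy
      exact SameOrderAt.of_comp IsOpenEmbedding.inr (N.compat e he e' he' _ hx hy)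

/-- The empty hypersurface. -/
def empty : Hypersurface where
  carrier := Empty
  charts := ∅
  cover x := x.elim
  compat _ h := h.elim

/-- The standard interval `[0,1]`, oriented from `0` to `1`. -/
def interval : Hypersurface where
  carrier := I
  charts := {⟨Set.univ, id, isOpen_univ, (Homeomorph.Set.univ I).isOpenEmbedding⟩}
  cover x := ⟨_, rfl, Set.mem_univ x⟩
  compat := by
    rintro _ rfl _ rfl x - -
    exact Eventually.of_forall fun _ => Iff.rfl

lemma interior_rev (M : Hypersurface) : M.rev.interior = M.interior := by
  have h : ∀ t : I, (0 < unitInterval.symm t ∧ unitInterval.symm t < 1) ↔ (0 < t ∧ t < 1) := by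
    intro t
    simp only [← Subtype.coe_lt_coe, unitInterval.coe_symm_eq, Set.Icc.coe_zero, Set.Icc.coe_one]
    constructor <;> rintro ⟨h0, h1⟩ <;> constructor <;> linarith
  ext x
  constructor
  · rintro ⟨_, ⟨e, he, rfl⟩, hx, h01⟩
    exact ⟨e, he, hx, (h (e.toFun x)).1 h01⟩
  · rintro ⟨e, he, hx, h01⟩
    exact ⟨_, ⟨e, he, rfl⟩, hx, (h (e.toFun x)).2 h01⟩

lemma inl_mem_interior_sum {M N : Hypersurface} {x : M.carrier} :
    (Sum.inl x : (M.sum N).carrier) ∈ (M.sum N).interior ↔ x ∈ M.interior := by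
  constructor
  · rintro ⟨_, ⟨e, he, rfl⟩ | ⟨e, he, rfl⟩, ⟨y, hy, hyx⟩, h⟩
    · obtain rfl := Sum.inl_injective hyx
      exact ⟨e, he, hy, h⟩
    · simp at hyx
  · rintro ⟨e, he, hx, h⟩
    exact ⟨_, Or.inl ⟨e, he, rfl⟩, ⟨x, hx, rfl⟩, h⟩

lemma inr_mem_interior_sum {M N : Hypersurface} {x : N.carrier} :
    (Sum.inr x : (M.sum N).carrier) ∈ (M.sum N).interior ↔ x ∈ N.interior := by
  constructor
  · rintro ⟨_, ⟨e, he, rfl⟩ | ⟨e, he, rfl⟩, ⟨y, hy, hyx⟩, h⟩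
    · simp at hyx
    · obtain rfl := Sum.inr_injective hyx
      exact ⟨e, he, hy, h⟩
  · rintro ⟨e, he, hx, h⟩
    exact ⟨_, Or.inr ⟨e, he, rfl⟩, ⟨x, hx, rfl⟩, h⟩

end Hypersurface

/-- A gluing function of hypersurfaces: a continuous closed surjection that restricts to an
embedding of the manifold interior and preserves orientation there. -/
@[ext]
structure HGluing (M N : Hypersurface) where
  toFun : M.carrier → N.carrier
  continuous_toFun : Continuous toFun
  surjective_toFun : Function.Surjective toFun
  isClosedMap_toFun : IsClosedMap toFun
  isEmbedding_interior : IsEmbedding (fun x : M.interior => toFun x)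
  orientation : ∀ x ∈ M.interior, ∀ e ∈ M.charts, x ∈ e.source →
    ∀ e' ∈ N.charts, toFun x ∈ e'.source → SameOrderAt e.toFun (fun y => e'.toFun (toFun y)) x

namespace HGluing

variable {M N M' N' L : Hypersurface}

instance : CoeFun (HGluing M N) fun _ => M.carrier → N.carrier := ⟨toFun⟩

/-- A homeomorphism that is increasing in suitable charts is a gluing function. -/
def ofHomeomorph (h : M.carrier ≃ₜ N.carrier)
    (ho : ∀ e ∈ M.charts, ∀ x ∈ e.source, ∃ e' ∈ N.charts, h x ∈ e'.source ∧
      SameOrderAt e.toFun (fun y => e'.toFun (h y)) x) : HGluing M N where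
  toFun := h
  continuous_toFun := h.continuous
  surjective_toFun := h.surjective
  isClosedMap_toFun := h.isClosedMap
  isEmbedding_interior := h.isEmbedding.comp IsEmbedding.subtypeVal
  orientation := by
    intro x _ e he hx e' he' hx'
    obtain ⟨e₁, he₁, hx₁, h₁⟩ := ho e he x hx
    exact h₁.trans (SameOrderAt.comp h.continuous.continuousAt (N.compat _ he₁ _ he' _ hx₁ hx'))

/-- The identity. -/
def id (M : Hypersurface) : HGluing M M :=
  ofHomeomorph (Homeomorph.refl _) fun e he _ hx =>
    ⟨e, he, hx, Eventually.of_forall fun _ => Iff.rfl⟩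

/-- A gluing function, with both orientations reversed. -/
def rev (f : HGluing M N) : HGluing M.rev N.rev where
  toFun := f.toFun
  continuous_toFun := f.continuous_toFun
  surjective_toFun := f.surjective_toFun
  isClosedMap_toFun := f.isClosedMap_toFun
  isEmbedding_interior :=
    f.isEmbedding_interior.comp (Homeomorph.setCongr M.interior_rev).isEmbedding
  orientation := by
    rintro x hx _ ⟨e, he, rfl⟩ hxe _ ⟨e', he', rfl⟩ hxe'
    rw [M.interior_rev] at hx
    exact SameOrderAt.sigma (f.orientation x hx e he hxe e' he' hxe')

/-- The disjoint union of two gluing functions. -/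
def sum (f : HGluing M M') (g : HGluing N N') : HGluing (M.sum N) (M'.sum N') where
  toFun := Sum.map f g
  continuous_toFun := f.continuous_toFun.sumMap g.continuous_toFun
  surjective_toFun := f.surjective_toFun.sumMap g.surjective_toFun
  isClosedMap_toFun := f.isClosedMap_toFun.sumMap g.isClosedMap_toFun
  isEmbedding_interior :=
    isEmbedding_sumMap f.isEmbedding_interior g.isEmbedding_interior
      (fun _ => Hypersurface.inl_mem_interior_sum) fun _ => Hypersurface.inr_mem_interior_sum
  orientation := by
    rintro (x | x) hx _ (⟨e, he, rfl⟩ | ⟨e, he, rfl⟩) ⟨y, hy, hyx⟩ _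
      (⟨e', he', rfl⟩ | ⟨e', he', rfl⟩) ⟨z, hz, hzx⟩ <;>
      first | (exfalso; simp at hyx; done) | (exfalso; simp at hzx; done) | skip
    · obtain rfl := Sum.inl_injective hyx
      obtain rfl := Sum.inl_injective hzx
      exact SameOrderAt.of_comp IsOpenEmbedding.inl
        (f.orientation y (Hypersurface.inl_mem_interior_sum.1 hx) e he hy e' he' hz)
    · obtain rfl := Sum.inr_injective hyx
      obtain rfl := Sum.inr_injective hzx
      exact SameOrderAt.of_comp IsOpenEmbedding.inr
        (g.orientation y (Hypersurface.inr_mem_interior_sum.1 hx) e he hy e' he' hz)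

/-- The identification of `M` with its double orientation reversal. -/
def revRev (M : Hypersurface) : HGluing M.rev.rev M :=
  ofHomeomorph (Homeomorph.refl _) <| by
    rintro _ ⟨_, ⟨e, he, rfl⟩, rfl⟩ x hx
    exact ⟨e, he, hx, SameOrderAt.of_eqOn e.open_source hx fun y _ => unitInterval.symm_symm _⟩

/-- The identification of `M ⊔ N` with `N ⊔ M`. -/
def sumSwap (M N : Hypersurface) : HGluing (M.sum N) (N.sum M) :=
  ofHomeomorph (Homeomorph.sumComm M.carrier N.carrier) <| by
    rintro _ (⟨e, he, rfl⟩ | ⟨e, he, rfl⟩) _ ⟨x, hx, rfl⟩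
    · exact ⟨_, Or.inr ⟨e, he, rfl⟩, ⟨x, hx, rfl⟩, SameOrderAt.of_comp IsOpenEmbedding.inl
        (SameOrderAt.of_eqOn e.open_source hx fun y _ => rfl)⟩
    · exact ⟨_, Or.inl ⟨e, he, rfl⟩, ⟨x, hx, rfl⟩, SameOrderAt.of_comp IsOpenEmbedding.inr
        (SameOrderAt.of_eqOn e.open_source hx fun y _ => rfl)⟩

/-- The identification of `(M ⊔ N) ⊔ L` with `M ⊔ (N ⊔ L)`. -/
def sumAssoc (M N L : Hypersurface) : HGluing ((M.sum N).sum L) (M.sum (N.sum L)) :=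
  ofHomeomorph (Homeomorph.sumAssoc M.carrier N.carrier L.carrier) <| by
    rintro _ (⟨_, ⟨e, he, rfl⟩ | ⟨e, he, rfl⟩, rfl⟩ | ⟨e, he, rfl⟩) _ hx
    · obtain ⟨_, ⟨x, hx, rfl⟩, rfl⟩ := hx
      exact ⟨_, Or.inl ⟨e, he, rfl⟩, ⟨x, hx, rfl⟩, SameOrderAt.of_comp
        (j := fun y : M.carrier => (Sum.inl (Sum.inl y) : (M.carrier ⊕ N.carrier) ⊕ L.carrier))
        (IsOpenEmbedding.inl.comp IsOpenEmbedding.inl)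
        (SameOrderAt.of_eqOn e.open_source hx fun y _ => rfl)⟩
    · obtain ⟨_, ⟨x, hx, rfl⟩, rfl⟩ := hx
      exact ⟨_, Or.inr ⟨_, Or.inl ⟨e, he, rfl⟩, rfl⟩, ⟨_, ⟨x, hx, rfl⟩, rfl⟩, SameOrderAt.of_comp
        (j := fun y : N.carrier => (Sum.inl (Sum.inr y) : (M.carrier ⊕ N.carrier) ⊕ L.carrier))
        (IsOpenEmbedding.inl.comp IsOpenEmbedding.inr)
        (SameOrderAt.of_eqOn e.open_source hx fun y _ => rfl)⟩
    · obtain ⟨x, hx, rfl⟩ := hx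
      exact ⟨_, Or.inr ⟨_, Or.inr ⟨e, he, rfl⟩, rfl⟩, ⟨_, ⟨x, hx, rfl⟩, rfl⟩, SameOrderAt.of_comp
        IsOpenEmbedding.inr
        (SameOrderAt.of_eqOn e.open_source hx fun y _ => rfl)⟩

/-- The identification of the orientation reversal of `N ⊔ M` with `rev M ⊔ rev N`. -/
def revSum (M N : Hypersurface) : HGluing (N.sum M).rev (M.rev.sum N.rev) :=
  ofHomeomorph (Homeomorph.sumComm N.carrier M.carrier) <| by
    rintro _ ⟨_, ⟨e, he, rfl⟩ | ⟨e, he, rfl⟩, rfl⟩ _ ⟨x, hx, rfl⟩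
    · exact ⟨_, Or.inr ⟨_, ⟨e, he, rfl⟩, rfl⟩, ⟨x, hx, rfl⟩, SameOrderAt.of_comp
        IsOpenEmbedding.inl (SameOrderAt.of_eqOn e.open_source hx fun y _ => rfl)⟩
    · exact ⟨_, Or.inl ⟨_, ⟨e, he, rfl⟩, rfl⟩, ⟨x, hx, rfl⟩, SameOrderAt.of_comp
        IsOpenEmbedding.inr (SameOrderAt.of_eqOn e.open_source hx fun y _ => rfl)⟩

end HGluing

/-! ## Regions: compact oriented topological surfaces with boundary -/

/-- The closed upper half-plane. -/
abbrev HalfPlane : Type := {z : ℂ // 0 ≤ z.im}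

namespace HalfPlane

/-- The reflection `z ↦ -conj z` of the closed upper half-plane. -/
noncomputable def reflect : HalfPlane ≃ₜ HalfPlane where
  toFun z := ⟨-conj z.1, by simpa using z.2⟩
  invFun z := ⟨-conj z.1, by simpa using z.2⟩
  left_inv z := by ext; simp
  right_inv z := by ext; simp
  continuous_toFun := by fun_prop
  continuous_invFun := by fun_prop

/-- A point of the closed upper half-plane. -/
def origin : HalfPlane := ⟨0, le_rfl⟩

end HalfPlane

/-- Let `e` be a chart of a surface and `x` a point with `e x` off the boundary line. The
complex-valued function `v` preserves orientation at `x`: as `c` runs counterclockwise, in the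
chart `e`, through a small circle around `x`, the curve `v ∘ c` winds once counterclockwise around
`v x`. -/
def OrientationPreservingAt {X : Type} [TopologicalSpace X] (e : LocalChart X HalfPlane)
    (v : X → ℂ) (x : X) : Prop :=
  ∀ᶠ r : ℝ in 𝓝[>] 0, ∀ c : ℝ → X,
    (∀ t, c t ∈ e.source ∧
      (e.toFun (c t) : ℂ) = (e.toFun x : ℂ) + (r : ℂ) * Complex.exp ((t : ℂ) * Complex.I)) →
    ∃ ρ θ : ℝ → ℝ, Continuous θ ∧ (∀ t, 0 < ρ t) ∧
      (∀ t, θ (t + 2 * Real.pi) = θ t + 2 * Real.pi) ∧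
      ∀ t, v (c t) = v x + (ρ t : ℂ) * Complex.exp ((θ t : ℂ) * Complex.I)

namespace OrientationPreservingAt

variable {X Y : Type} [TopologicalSpace X] [TopologicalSpace Y]

lemma reflect {e : LocalChart X HalfPlane} {v : X → ℂ} {x : X}
    (h : OrientationPreservingAt e v x) :
    OrientationPreservingAt (e.post HalfPlane.reflect) (fun y => -conj (v y)) x := by
  filter_upwards [h] with r hr c hc
  have key : ∀ t : ℝ, conj (Complex.exp ((t : ℂ) * Complex.I)) =
      -Complex.exp (((Real.pi - t : ℝ) : ℂ) * Complex.I) := by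
    intro t
    rw [← Complex.exp_conj]
    push_cast
    rw [sub_mul, Complex.exp_sub, Complex.exp_pi_mul_I]
    simp only [map_mul, Complex.conj_ofReal, Complex.conj_I, mul_neg, Complex.exp_neg]
    field_simp
  have h1 : ∀ t, c (Real.pi - t) ∈ e.source ∧ (e.toFun (c (Real.pi - t)) : ℂ) =
      (e.toFun x : ℂ) + (r : ℂ) * Complex.exp ((t : ℂ) * Complex.I) := by
    intro t
    obtain ⟨hs, he⟩ := hc (Real.pi - t)
    refine ⟨hs, ?_⟩
    have he' : -conj (e.toFun (c (Real.pi - t)) : ℂ) = -conj (e.toFun x : ℂ) +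
        (r : ℂ) * Complex.exp (((Real.pi - t : ℝ) : ℂ) * Complex.I) := he
    have := congrArg (fun z => -conj z) he'
    simp only [map_neg, map_add, map_mul, Complex.conj_conj, key, Complex.conj_ofReal] at this
    rw [show Real.pi - (Real.pi - t) = t by ring] at this
    linear_combination this
  obtain ⟨ρ, θ, hθ, hρ, hper, hv⟩ := hr _ h1
  refine ⟨fun t => ρ (Real.pi - t), fun t => Real.pi - θ (Real.pi - t), by fun_prop,
    fun t => hρ _, fun t => ?_, fun t => ?_⟩
  · have := hper (Real.pi - (t + 2 * Real.pi))
    rw [show Real.pi - (t + 2 * Real.pi) + 2 * Real.pi = Real.pi - t by ring] at this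
    linarith
  · have := hv (Real.pi - t)
    rw [show Real.pi - (Real.pi - t) = t by ring] at this
    rw [this]
    simp only [map_add, map_mul, key, Complex.conj_ofReal]
    ring

lemma push {e : LocalChart X HalfPlane} {j : X → Y} {hj : IsOpenEmbedding j} {g : Y → HalfPlane}
    {hg : ∀ x, g (j x) = e.toFun x} {v : Y → ℂ} {x : X}
    (h : OrientationPreservingAt e (fun y => v (j y)) x) :
    OrientationPreservingAt (e.push j hj g hg) v (j x) := by
  filter_upwards [h] with r hr c hc
  have hc0 : ∀ t, ∃ y, y ∈ e.source ∧ j y = c t := fun t => (hc t).1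
  choose d hd hdc using hc0
  obtain ⟨ρ, θ, hθ, hρ, hper, hv⟩ := hr d fun t => ⟨hd t, by
    have h2 : (g (c t) : ℂ) = (g (j x) : ℂ) + (r : ℂ) * Complex.exp ((t : ℂ) * Complex.I) :=
      (hc t).2
    rwa [← hdc t, hg, hg] at h2⟩
  exact ⟨ρ, θ, hθ, hρ, hper, fun t => by rw [← hdc t]; exact hv t⟩

end OrientationPreservingAt

/-- A region: a compact Hausdorff space with an oriented atlas modelled on open subsets of the
closed upper half-plane, that is, a compact oriented topological surface with (possibly empty)
boundary. -/
structure Region where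
  carrier : Type
  [topology : TopologicalSpace carrier]
  [compact : CompactSpace carrier]
  [hausdorff : T2Space carrier]
  charts : Set (LocalChart carrier HalfPlane)
  cover : ∀ x, ∃ e ∈ charts, x ∈ e.source
  compat_boundary : ∀ e ∈ charts, ∀ e' ∈ charts, ∀ x, x ∈ e.source → x ∈ e'.source →
    (e.toFun x).1.im = 0 → (e'.toFun x).1.im = 0
  compat_interior : ∀ e ∈ charts, ∀ e' ∈ charts, ∀ x, x ∈ e.source → x ∈ e'.source →
    0 < (e.toFun x).1.im → OrientationPreservingAt e (fun y => (e'.toFun y : ℂ)) x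
  compat_order : ∀ e ∈ charts, ∀ e' ∈ charts, ∀ x, x ∈ e.source → x ∈ e'.source →
    (e.toFun x).1.im = 0 → ∀ᶠ p in 𝓝 (x, x), (e.toFun p.1).1.im = 0 → (e.toFun p.2).1.im = 0 →
      ((e.toFun p.1).1.re < (e.toFun p.2).1.re ↔ (e'.toFun p.1).1.re < (e'.toFun p.2).1.re)

attribute [instance] Region.topology Region.compact Region.hausdorff

namespace Region

/-- The manifold interior. -/
def interior (X : Region) : Set X.carrier :=
  {x | ∃ e ∈ X.charts, x ∈ e.source ∧ 0 < (e.toFun x).1.im}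

/-- The set of boundary points. -/
def boundarySet (X : Region) : Set X.carrier :=
  {x | ∃ e ∈ X.charts, x ∈ e.source ∧ (e.toFun x).1.im = 0}

lemma mem_boundarySet_iff (X : Region) {x : X.carrier} {e : LocalChart X.carrier HalfPlane}
    (he : e ∈ X.charts) (hx : x ∈ e.source) : x ∈ X.boundarySet ↔ (e.toFun x).1.im = 0 := by
  constructor
  · rintro ⟨e', he', hx', h⟩
    exact X.compat_boundary e' he' e he x hx' hx h
  · exact fun h => ⟨e, he, hx, h⟩

lemma isClosed_boundarySet (X : Region) : IsClosed X.boundarySet := by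
  rw [← isOpen_compl_iff, isOpen_iff_mem_nhds]
  intro x hx
  obtain ⟨e, he, hxe⟩ := X.cover x
  have hcont : ContinuousOn e.toFun e.source :=
    continuousOn_iff_continuous_domRestrict.2 e.isOpenEmbedding.continuous
  have hat : ContinuousAt e.toFun x := hcont.continuousAt (e.open_source.mem_nhds hxe)
  have him : ContinuousAt (fun y => (e.toFun y).1.im) x :=
    (Complex.continuous_im.comp continuous_subtype_val).continuousAt.comp hat
  have hne : (e.toFun x).1.im ≠ 0 := fun h => hx ((X.mem_boundarySet_iff he hxe).2 h)
  filter_upwards [him.eventually_ne hne, e.open_source.mem_nhds hxe] with y hy hye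
  exact fun h => hy ((X.mem_boundarySet_iff he hye).1 h)

/-- The chart of the boundary induced by a chart of the region. Its coordinate is the real part of
the half-plane coordinate, transferred to `(0,1)` by the increasing homeomorphism
`unitInterval.sigmoid`. -/
noncomputable def boundaryChart (X : Region) (e : LocalChart X.carrier HalfPlane)
    (he : e ∈ X.charts) : LocalChart X.boundarySet I where
  source := {x | (x : X.carrier) ∈ e.source}
  toFun := fun x => unitInterval.sigmoid (e.toFun x).1.re
  open_source := e.open_source.preimage continuous_subtype_val
  isOpenEmbedding := by
    let S : Set X.boundarySet := {x | (x : X.carrier) ∈ e.source}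
    have hcont : Continuous fun x : S => e.toFun x.1.1 :=
      e.isOpenEmbedding.continuous.comp
        (Continuous.subtype_mk (continuous_subtype_val.comp continuous_subtype_val) fun x => x.2)
    have hre : Continuous fun x : S => (e.toFun x.1.1).1.re :=
      Complex.continuous_re.comp (continuous_subtype_val.comp hcont)
    have him : ∀ x : S, (e.toFun x.1.1).1.im = 0 := fun x =>
      (X.mem_boundarySet_iff he x.2).1 x.1.2
    let r : ℝ → HalfPlane := fun t => ⟨(t : ℂ), by simp⟩
    have hr : Continuous r := by fun_prop
    have hcomp : ∀ x : S, r (e.toFun x.1.1).1.re = e.toFun x.1.1 := by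
      intro x
      apply Subtype.ext
      apply Complex.ext <;> simp [r, him x]
    have hemb1 : IsEmbedding fun x : S => e.toFun x.1.1 := by
      have h1 : IsEmbedding fun x : S => (⟨x.1.1, x.2⟩ : e.source) :=
        (IsEmbedding.subtypeVal.comp IsEmbedding.subtypeVal).codRestrict e.source fun x => x.2
      exact e.isOpenEmbedding.isEmbedding.comp h1
    have hemb : IsEmbedding fun x : S => (e.toFun x.1.1).1.re := by
      refine IsEmbedding.of_comp hre hr ?_
      have : r ∘ (fun x : S => (e.toFun x.1.1).1.re) = fun x : S => e.toFun x.1.1 :=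
        funext hcomp
      rwa [this]
    have hopen : IsOpen (Set.range fun x : S => (e.toFun x.1.1).1.re) := by
      have : (Set.range fun x : S => (e.toFun x.1.1).1.re) =
          r ⁻¹' Set.range (fun x : e.source => e.toFun x) := by
        ext t
        constructor
        · rintro ⟨x, rfl⟩
          exact ⟨⟨x.1.1, x.2⟩, (hcomp x).symm⟩
        · rintro ⟨x, hx⟩
          have hx0 : (e.toFun x.1).1 = (t : ℂ) := congrArg Subtype.val hx
          have hb : x.1 ∈ X.boundarySet :=
            (X.mem_boundarySet_iff he x.2).2 (by rw [hx0]; simp)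
          exact ⟨⟨⟨x.1, hb⟩, x.2⟩, by simp [hx0]⟩
      rw [this]
      exact e.isOpenEmbedding.isOpen_range.preimage hr
    have hsig : IsOpenEmbedding unitInterval.sigmoid :=
      ⟨Topology.isEmbedding_sigmoid, by rw [unitInterval.range_sigmoid]; exact isOpen_Ioo⟩
    exact hsig.comp ⟨hemb, hopen⟩

/-- The boundary of a region, with the induced orientation (the region lies to the left). -/
noncomputable def boundary (X : Region) : Hypersurface where
  carrier := X.boundarySet
  compact := isCompact_iff_compactSpace.1 X.isClosed_boundarySet.isCompact
  charts := {d | ∃ e, ∃ he : e ∈ X.charts, d = X.boundaryChart e he}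
  cover x := by
    obtain ⟨e, he, hx⟩ := X.cover x
    exact ⟨_, ⟨e, he, rfl⟩, hx⟩
  compat := by
    rintro _ ⟨e, he, rfl⟩ _ ⟨e', he', rfl⟩ x hx hx'
    have hval : Tendsto (Prod.map Subtype.val Subtype.val : X.boundarySet × X.boundarySet → _)
        (𝓝 (x, x)) (𝓝 ((x : X.carrier), (x : X.carrier))) :=
      (continuous_subtype_val.prodMap continuous_subtype_val).tendsto _
    have hs : ∀ᶠ p : X.boundarySet × X.boundarySet in 𝓝 (x, x),
        (p.1 : X.carrier) ∈ e.source ∧ (p.2 : X.carrier) ∈ e.source :=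
      hval.eventually ((e.open_source.prod e.open_source).mem_nhds ⟨hx, hx⟩)
    filter_upwards [hs, hval.eventually (X.compat_order e he e' he' x hx hx'
      ((X.mem_boundarySet_iff he hx).1 x.2))] with p hp h
    have := h ((X.mem_boundarySet_iff he hp.1).1 p.1.2) ((X.mem_boundarySet_iff he hp.2).1 p.2.2)
    simpa only [boundaryChart, unitInterval.sigmoid_lt_iff, Prod.map] using this

/-- Orientation reversal. -/
noncomputable def rev (X : Region) : Region where
  carrier := X.carrier
  charts := {e | ∃ e₀ ∈ X.charts, e = e₀.post HalfPlane.reflect}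
  cover x := by
    obtain ⟨e, he, hx⟩ := X.cover x
    exact ⟨_, ⟨e, he, rfl⟩, hx⟩
  compat_boundary := by
    rintro _ ⟨e, he, rfl⟩ _ ⟨e', he', rfl⟩ x hx hx' h
    have := X.compat_boundary e he e' he' x hx hx'
      (by simpa [LocalChart.post, HalfPlane.reflect] using h)
    simpa [LocalChart.post, HalfPlane.reflect] using this
  compat_interior := by
    rintro _ ⟨e, he, rfl⟩ _ ⟨e', he', rfl⟩ x hx hx' h
    exact (X.compat_interior e he e' he' x hx hx'
      (by simpa [LocalChart.post, HalfPlane.reflect] using h)).reflect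
  compat_order := by
    rintro _ ⟨e, he, rfl⟩ _ ⟨e', he', rfl⟩ x hx hx' h
    have hs : Tendsto (Prod.swap : X.carrier × X.carrier → X.carrier × X.carrier)
      (𝓝 (x, x)) (𝓝 (x, x)) := continuous_swap.tendsto' _ _ rfl
    filter_upwards [hs.eventually (X.compat_order e he e' he' x hx hx'
      (by simpa [LocalChart.post, HalfPlane.reflect] using h))] with p hp h1 h2
    have := hp (by simpa [LocalChart.post, HalfPlane.reflect] using h2)
      (by simpa [LocalChart.post, HalfPlane.reflect] using h1)
    simpa [LocalChart.post, HalfPlane.reflect] using this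

/-- Disjoint union. -/
def sum (X Y : Region) : Region where
  carrier := X.carrier ⊕ Y.carrier
  charts := {e | (∃ e₀ ∈ X.charts, e = e₀.inl HalfPlane.origin) ∨
    ∃ e₀ ∈ Y.charts, e = e₀.inr HalfPlane.origin}
  cover := by
    rintro (x | x)
    · obtain ⟨e, he, hx⟩ := X.cover x
      exact ⟨_, Or.inl ⟨e, he, rfl⟩, x, hx, rfl⟩
    · obtain ⟨e, he, hx⟩ := Y.cover x
      exact ⟨_, Or.inr ⟨e, he, rfl⟩, x, hx, rfl⟩
  compat_boundary := by
    rintro _ (⟨e, he, rfl⟩ | ⟨e, he, rfl⟩) _ (⟨e', he', rfl⟩ | ⟨e', he', rfl⟩) _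
      ⟨x, hx, rfl⟩ ⟨y, hy, hxy⟩ h
    · obtain rfl := Sum.inl_injective hxy
      exact X.compat_boundary e he e' he' _ hx hy h
    · simp at hxy
    · simp at hxy
    · obtain rfl := Sum.inr_injective hxy
      exact Y.compat_boundary e he e' he' _ hx hy h
  compat_interior := by
    rintro _ (⟨e, he, rfl⟩ | ⟨e, he, rfl⟩) _ (⟨e', he', rfl⟩ | ⟨e', he', rfl⟩) _
      ⟨x, hx, rfl⟩ ⟨y, hy, hxy⟩ h
    · obtain rfl := Sum.inl_injective hxy
      exact OrientationPreservingAt.push (X.compat_interior e he e' he' _ hx hy h)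
    · simp at hxy
    · simp at hxy
    · obtain rfl := Sum.inr_injective hxy
      exact OrientationPreservingAt.push (Y.compat_interior e he e' he' _ hx hy h)
  compat_order := by
    rintro _ (⟨e, he, rfl⟩ | ⟨e, he, rfl⟩) _ (⟨e', he', rfl⟩ | ⟨e', he', rfl⟩) _
      ⟨x, hx, rfl⟩ ⟨y, hy, hxy⟩ h
    · obtain rfl := Sum.inl_injective hxy
      have h2 := (IsOpenEmbedding.inl.prodMap IsOpenEmbedding.inl :
        IsOpenEmbedding (Prod.map (Sum.inl : X.carrier → X.carrier ⊕ Y.carrier)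
          (Sum.inl : X.carrier → X.carrier ⊕ Y.carrier))).map_nhds_eq (y, y)
      rw [show ((Sum.inl y, Sum.inl y) : (X.carrier ⊕ Y.carrier) × (X.carrier ⊕ Y.carrier)) =
        Prod.map Sum.inl Sum.inl (y, y) from rfl, ← h2]
      exact X.compat_order e he e' he' _ hx hy h
    · simp at hxy
    · simp at hxy
    · obtain rfl := Sum.inr_injective hxy
      have h2 := (IsOpenEmbedding.inr.prodMap IsOpenEmbedding.inr :
        IsOpenEmbedding (Prod.map (Sum.inr : Y.carrier → X.carrier ⊕ Y.carrier)
          (Sum.inr : Y.carrier → X.carrier ⊕ Y.carrier))).map_nhds_eq (y, y)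
      rw [show ((Sum.inr y, Sum.inr y) : (X.carrier ⊕ Y.carrier) × (X.carrier ⊕ Y.carrier)) =
        Prod.map Sum.inr Sum.inr (y, y) from rfl, ← h2]
      exact Y.compat_order e he e' he' _ hx hy h

/-- The empty region. -/
def empty : Region where
  carrier := Empty
  charts := ∅
  cover x := x.elim
  compat_boundary _ h := h.elim
  compat_interior _ h := h.elim
  compat_order _ h := h.elim

end Region

/-- The closed unit disk in the complex plane. -/
abbrev Disk : Type := Metric.closedBall (0 : ℂ) 1

namespace Disk

/-- The Cayley transform `z ↦ i (1 + z) / (1 - z)` of the unit disk to the half-plane. -/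
noncomputable def cayley (z : Disk) : HalfPlane :=
  ⟨Complex.I * (1 + z.1) / (1 - z.1), by
    have hz : Complex.normSq z.1 ≤ 1 := by
      have := z.2
      rw [mem_closedBall_zero_iff] at this
      rw [Complex.normSq_eq_norm_sq]
      nlinarith [norm_nonneg z.1]
    rw [Complex.div_im]
    rw [Complex.normSq_apply] at hz
    simp only [Complex.mul_re, Complex.mul_im, Complex.I_re, Complex.I_im, Complex.add_re,
      Complex.add_im, Complex.sub_re, Complex.sub_im, Complex.one_re, Complex.one_im]
    rw [← sub_div]
    apply div_nonneg _ (Complex.normSq_nonneg _)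
    nlinarith⟩

/-- The inverse `w ↦ (w - i) / (w + i)` of the Cayley transform. -/
noncomputable def cayleyInv (w : HalfPlane) : Disk :=
  ⟨(w.1 - Complex.I) / (w.1 + Complex.I), by
    rw [mem_closedBall_zero_iff, norm_div]
    apply div_le_one_of_le₀ _ (norm_nonneg _)
    apply le_of_sq_le_sq _ (norm_nonneg _)
    rw [← Complex.normSq_eq_norm_sq, ← Complex.normSq_eq_norm_sq, Complex.normSq_apply,
      Complex.normSq_apply]
    have := w.2
    simp
    nlinarith⟩

lemma add_I_ne_zero (w : HalfPlane) : w.1 + Complex.I ≠ 0 := by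
  intro h
  have := congrArg Complex.im h
  have := w.2
  simp at *
  linarith

lemma cayley_cayleyInv (w : HalfPlane) : cayley (cayleyInv w) = w := by
  apply Subtype.ext
  have h := add_I_ne_zero w
  have h2 : (1 : ℂ) - (w.1 - Complex.I) / (w.1 + Complex.I) ≠ 0 := by
    rw [one_sub_div h]
    simp [h]
  simp only [cayley, cayleyInv]
  field_simp
  ring

lemma one_sub_ne_zero {z : Disk} (hz : z.1 ≠ 1) : (1 : ℂ) - z.1 ≠ 0 := sub_ne_zero.2 hz.symm

lemma cayleyInv_cayley {z : Disk} (hz : z.1 ≠ 1) : cayleyInv (cayley z) = z := by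
  apply Subtype.ext
  have h := one_sub_ne_zero hz
  have h2 : Complex.I * (1 + z.1) / (1 - z.1) + Complex.I ≠ 0 := add_I_ne_zero (cayley z)
  simp only [cayley, cayleyInv]
  rw [div_eq_iff h2]
  field_simp
  ring

lemma cayleyInv_ne (w : HalfPlane) : (cayleyInv w).1 ≠ 1 := by
  simp only [cayleyInv, ne_eq]
  rw [div_eq_one_iff_eq (add_I_ne_zero w)]
  intro h
  have := congrArg Complex.im h
  simp at this
  linarith

/-- The Cayley transform as a homeomorphism from the disk without `1` to the half-plane. -/
noncomputable def cayleyHomeo : {z : Disk | z.1 ≠ 1} ≃ₜ HalfPlane where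
  toFun z := cayley z.1
  invFun w := ⟨cayleyInv w, cayleyInv_ne w⟩
  left_inv z := Subtype.ext (cayleyInv_cayley z.2)
  right_inv w := cayley_cayleyInv w
  continuous_toFun := by
    refine Continuous.subtype_mk (Continuous.div (by fun_prop) (by fun_prop) ?_) _
    exact fun z => one_sub_ne_zero z.2
  continuous_invFun := by
    refine Continuous.subtype_mk (Continuous.subtype_mk
      (Continuous.div (by fun_prop) (by fun_prop) add_I_ne_zero) _) _

/-- The chart of the disk given by the Cayley transform. -/
noncomputable def chart : LocalChart Disk HalfPlane where
  source := {z | z.1 ≠ 1}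
  toFun := cayley
  open_source := isOpen_ne_fun continuous_subtype_val continuous_const
  isOpenEmbedding := cayleyHomeo.isOpenEmbedding

/-- The rotation of the disk by half a turn. -/
def neg : Disk ≃ₜ Disk where
  toFun z := ⟨-z.1, by have := z.2; rw [mem_closedBall_zero_iff] at *; rwa [norm_neg]⟩
  invFun z := ⟨-z.1, by have := z.2; rw [mem_closedBall_zero_iff] at *; rwa [norm_neg]⟩
  left_inv z := by ext; simp
  right_inv z := by ext; simp
  continuous_toFun := by fun_prop
  continuous_invFun := by fun_prop

/-- The second chart of the disk, defined away from `-1`. -/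
noncomputable def chartNeg : LocalChart Disk HalfPlane :=
  chart.push neg neg.isOpenEmbedding (fun z => cayley (neg z)) fun z => by
    show cayley (neg (neg z)) = cayley z
    rw [show neg (neg z) = z from neg.left_inv z]

lemma mem_source_chartNeg {z : Disk} : z ∈ chartNeg.source ↔ (neg z).1 ≠ 1 := by
  constructor
  · rintro ⟨y, hy, rfl⟩
    rwa [show neg (neg y) = y from neg.left_inv y]
  · intro h
    exact ⟨neg z, h, neg.left_inv z⟩

lemma cayley_neg {z : Disk} (hz : z.1 ≠ 1) (hz' : (neg z).1 ≠ 1) :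
    (cayley (neg z)).1 * (cayley z).1 = -1 := by
  have h := one_sub_ne_zero hz
  have h2 : (1 : ℂ) + z.1 ≠ 0 := by
    have := one_sub_ne_zero hz'
    simpa [neg] using this
  have h3 : (neg z).1 = -z.1 := rfl
  simp only [cayley, h3]
  rw [sub_neg_eq_add, ← sub_eq_add_neg]
  field_simp
  simp

lemma ne_of_cayley_ne_zero {z : Disk} (h : (cayley z).1 ≠ 0) : (neg z).1 ≠ 1 := by
  intro hz
  apply h
  have h3 : (neg z).1 = -z.1 := rfl
  have h4 : z.1 = -1 := by rw [← neg_eq_iff_eq_neg, ← h3, hz]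
  simp [cayley, h4]

lemma orientation_self {X : Type} [TopologicalSpace X] (e : LocalChart X HalfPlane) (x : X) :
    OrientationPreservingAt e (fun y => (e.toFun y : ℂ)) x := by
  filter_upwards [self_mem_nhdsWithin] with r hr c hc
  exact ⟨fun _ => r, fun t => t, continuous_id, fun _ => hr, fun _ => rfl, fun t => (hc t).2⟩

lemma orientation_inv {X : Type} [TopologicalSpace X] (e : LocalChart X HalfPlane) (v : X → ℂ)
    (x : X) (hxe : x ∈ e.source) (hx : 0 < (e.toFun x).1.im)
    (h : ∀ y ∈ e.source, (e.toFun y).1 ≠ 0 → v y * (e.toFun y).1 = -1) :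
    OrientationPreservingAt e v x := by
  set w : ℂ := (e.toFun x).1 with hw
  have hw0 : w ≠ 0 := by
    intro h0
    rw [h0] at hx
    simp at hx
  have hpos : 0 < ‖w‖ := norm_pos_iff.2 hw0
  filter_upwards [self_mem_nhdsWithin, nhdsWithin_le_nhds (Iio_mem_nhds hpos)] with r hr hrw c hc
  have hr0 : 0 < r := hr
  have hrw' : r < ‖w‖ := hrw
  have hr0' : (r : ℂ) ≠ 0 := by exact_mod_cast hr0.ne'
  let E : ℝ → ℂ := fun t => Complex.exp ((t : ℂ) * Complex.I)
  have hE : ∀ t, ‖E t‖ = 1 := fun t => Complex.norm_exp_ofReal_mul_I t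
  have hper : ∀ t, E (t + 2 * Real.pi) = E t := by
    intro t
    simp only [E]
    push_cast
    rw [add_mul, Complex.exp_periodic]
  let q : ℝ → ℂ := fun t => 1 + (r : ℂ) / w * E t
  have hqs : ∀ t, q t ∈ Complex.slitPlane := by
    intro t
    apply Complex.mem_slitPlane_of_norm_lt_one
    rw [norm_mul, hE, mul_one, norm_div, Complex.norm_real, Real.norm_of_nonneg hr0.le]
    exact (div_lt_one hpos).2 hrw'
  have hq0 : ∀ t, q t ≠ 0 := fun t => Complex.slitPlane_ne_zero (hqs t)
  have hqc : Continuous q := by fun_prop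
  have hwq : ∀ t, w + (r : ℂ) * E t = w * q t := by
    intro t
    simp only [q]
    field_simp
  refine ⟨fun t => r / (‖w‖ ^ 2 * ‖q t‖), fun t => t - 2 * w.arg - (q t).arg, ?_, ?_, ?_, ?_⟩
  · exact (continuous_id.sub continuous_const).sub
      (continuous_iff_continuousAt.2 fun t => (Complex.continuousAt_arg (hqs t)).comp
        hqc.continuousAt)
  · intro t
    have := norm_pos_iff.2 (hq0 t)
    positivity
  · intro t
    simp only [q, hper]
    ring
  · intro t
    obtain ⟨hs, he⟩ := hc t
    have he' : (e.toFun (c t)).1 = w * q t := he.trans (hwq t)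
    have hne : (e.toFun (c t)).1 ≠ 0 := by rw [he']; exact mul_ne_zero hw0 (hq0 t)
    have h1 : v (c t) = -1 / (w * q t) := by
      rw [eq_div_iff (mul_ne_zero hw0 (hq0 t)), ← he']
      exact h _ hs hne
    have h2 : v x = -1 / w := by
      rw [eq_div_iff hw0]
      exact h _ hxe hw0
    have hexp : ∀ z : ℂ, z ≠ 0 → Complex.exp ((z.arg : ℂ) * Complex.I) = z / ‖z‖ := by
      intro z hz
      have hz' : (‖z‖ : ℂ) ≠ 0 := by exact_mod_cast norm_ne_zero_iff.2 hz
      rw [eq_div_iff hz', mul_comm]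
      exact Complex.norm_mul_exp_arg_mul_I z
    have h3 : Complex.exp (((t - 2 * w.arg - (q t).arg : ℝ) : ℂ) * Complex.I) =
        E t / (w / ‖w‖) ^ 2 / (q t / ‖q t‖) := by
      rw [← hexp w hw0, ← hexp _ (hq0 t), ← Complex.exp_nat_mul, ← Complex.exp_sub,
        ← Complex.exp_sub]
      congr 1
      push_cast
      ring
    have hwn : (‖w‖ : ℂ) ≠ 0 := by exact_mod_cast hpos.ne'
    have hqn : (‖q t‖ : ℂ) ≠ 0 := by exact_mod_cast norm_ne_zero_iff.2 (hq0 t)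
    have hq1 : w * q t = w + (r : ℂ) * E t := (hwq t).symm
    have hqt := hq0 t
    rw [h1, h2, h3]
    push_cast
    field_simp
    linear_combination hq1

lemma order_inv {a b a' b' : ℝ} (hab : 0 < a * b) (ha : a' * a = -1) (hb : b' * b = -1) :
    a < b ↔ a' < b' := by
  have h1 : b - a = (b' - a') * (a * b) := by linear_combination (-a) * hb + b * ha
  rw [← sub_pos, h1, mul_pos_iff_of_pos_right hab, sub_pos]

lemma compat_order_aux {X : Type} [TopologicalSpace X] (e : LocalChart X HalfPlane)
    (v : X → HalfPlane) (x : X) (hxe : x ∈ e.source) (hx : (e.toFun x).1 ≠ 0)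
    (h : ∀ y ∈ e.source, (e.toFun y).1 ≠ 0 → (v y).1 * (e.toFun y).1 = -1)
    (hx0 : (e.toFun x).1.im = 0) :
    ∀ᶠ p in 𝓝 (x, x), (e.toFun p.1).1.im = 0 → (e.toFun p.2).1.im = 0 →
      ((e.toFun p.1).1.re < (e.toFun p.2).1.re ↔ (v p.1).1.re < (v p.2).1.re) := by
  have hcont : ContinuousOn e.toFun e.source :=
    continuousOn_iff_continuous_domRestrict.2 e.isOpenEmbedding.continuous
  have hat : ContinuousAt e.toFun x := hcont.continuousAt (e.open_source.mem_nhds hxe)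
  have hre : ContinuousAt (fun y => (e.toFun y).1.re) x :=
    (Complex.continuous_re.comp continuous_subtype_val).continuousAt.comp hat
  have hprod : ContinuousAt (fun p : X × X => (e.toFun p.1).1.re * (e.toFun p.2).1.re) (x, x) :=
    (ContinuousAt.comp (f := Prod.fst) (x := (x, x)) hre continuousAt_fst).mul
      (ContinuousAt.comp (f := Prod.snd) (x := (x, x)) hre continuousAt_snd)
  have hre0 : (e.toFun x).1.re ≠ 0 := fun h0 => hx (Complex.ext h0 hx0)
  have hev := hprod.eventually_const_lt (u := 0) (mul_self_pos.2 hre0)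
  filter_upwards [hev, (e.open_source.prod e.open_source).mem_nhds
    (show (x, x) ∈ e.source ×ˢ e.source from ⟨hxe, hxe⟩)] with p hp hps h1 h2
  have key : ∀ y ∈ e.source, (e.toFun y).1.im = 0 → (e.toFun y).1.re ≠ 0 →
      (v y).1.re * (e.toFun y).1.re = -1 := by
    intro y hy hy0 hyr
    have := congrArg Complex.re (h y hy fun h0 => hyr (by rw [h0]; simp))
    simpa [hy0] using this
  have hp' : 0 < (e.toFun p.1).1.re * (e.toFun p.2).1.re := hp
  exact order_inv hp (key _ hps.1 h1 (left_ne_zero_of_mul hp'.ne'))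
    (key _ hps.2 h2 (right_ne_zero_of_mul hp'.ne'))

lemma chart_chartNeg : ∀ y ∈ chart.source, (chart.toFun y).1 ≠ 0 →
    (chartNeg.toFun y).1 * (chart.toFun y).1 = -1 :=
  fun _ hy h0 => cayley_neg hy (ne_of_cayley_ne_zero h0)

lemma chartNeg_chart : ∀ y ∈ chartNeg.source, (chartNeg.toFun y).1 ≠ 0 →
    (chart.toFun y).1 * (chartNeg.toFun y).1 = -1 := by
  intro y hy h0
  have h1 := ne_of_cayley_ne_zero (z := neg y) h0
  rw [show neg (neg y) = y from neg.left_inv y] at h1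
  rw [mul_comm]
  exact cayley_neg h1 (mem_source_chartNeg.1 hy)

lemma ne_zero_left {y : Disk} (hy : y ∈ chart.source) (hy' : y ∈ chartNeg.source) :
    (chart.toFun y).1 ≠ 0 ∧ (chartNeg.toFun y).1 ≠ 0 := by
  have h := cayley_neg hy (mem_source_chartNeg.1 hy')
  constructor
  · intro h0
    rw [show (cayley y).1 = 0 from h0] at h
    simp at h
  · intro h0
    rw [show (cayley (neg y)).1 = 0 from h0] at h
    simp at h

lemma im_eq_zero_of_mul {a b : ℂ} (h : a * b = -1) (hb : b.im = 0) : a.im = 0 := by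
  have h1 := congrArg Complex.im h
  have h2 := congrArg Complex.re h
  simp only [Complex.mul_im, Complex.mul_re, hb, Complex.neg_re, Complex.neg_im, Complex.one_re,
    Complex.one_im, mul_zero, zero_add, sub_zero, neg_zero] at h1 h2
  rcases mul_eq_zero.1 h1 with h3 | h3
  · exact h3
  · rw [h3] at h2
    simp at h2

end Disk

/-- The standard disk: the closed unit disk with its standard orientation. Its boundary is the unit
circle, oriented counterclockwise. -/
noncomputable def Region.disk : Region where
  carrier := Disk
  compact := isCompact_iff_compactSpace.1 (isCompact_closedBall _ _)
  charts := {Disk.chart, Disk.chartNeg}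
  cover z := by
    by_cases h : z.1 = 1
    · refine ⟨_, Or.inr rfl, Disk.mem_source_chartNeg.2 ?_⟩
      show -z.1 ≠ 1
      rw [h]
      norm_num
    · exact ⟨_, Or.inl rfl, h⟩
  compat_boundary := by
    rintro _ (rfl | rfl) _ (rfl | rfl) x hx hx' h
    · exact h
    · exact Disk.im_eq_zero_of_mul (Disk.chart_chartNeg x hx (Disk.ne_zero_left hx hx').1) h
    · exact Disk.im_eq_zero_of_mul (Disk.chartNeg_chart x hx (Disk.ne_zero_left hx' hx).2) h
    · exact h
  compat_interior := by
    rintro _ (rfl | rfl) _ (rfl | rfl) x hx hx' h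
    · exact Disk.orientation_self _ _
    · exact Disk.orientation_inv _ _ x hx h Disk.chart_chartNeg
    · exact Disk.orientation_inv _ _ x hx h Disk.chartNeg_chart
    · exact Disk.orientation_self _ _
  compat_order := by
    rintro _ (rfl | rfl) _ (rfl | rfl) x hx hx' h
    · exact Eventually.of_forall fun _ _ _ => Iff.rfl
    · exact Disk.compat_order_aux _ _ x hx (Disk.ne_zero_left hx hx').1 Disk.chart_chartNeg h
    · exact Disk.compat_order_aux _ _ x hx (Disk.ne_zero_left hx' hx).2 Disk.chartNeg_chart h
    · exact Eventually.of_forall fun _ _ _ => Iff.rfl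

/-- A gluing function of regions: a continuous closed surjection that restricts to an embedding of
the manifold interior and preserves orientation there. -/
@[ext]
structure RGluing (X X' : Region) where
  toFun : X.carrier → X'.carrier
  continuous_toFun : Continuous toFun
  surjective_toFun : Function.Surjective toFun
  isClosedMap_toFun : IsClosedMap toFun
  isEmbedding_interior : IsEmbedding (fun x : X.interior => toFun x)
  orientation : ∀ x ∈ X.interior, ∀ e ∈ X.charts, x ∈ e.source →
    ∀ e' ∈ X'.charts, toFun x ∈ e'.source →
      OrientationPreservingAt e (fun y => (e'.toFun (toFun y) : ℂ)) x

instance {X X' : Region} : CoeFun (RGluing X X') fun _ => X.carrier → X'.carrier :=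
  ⟨RGluing.toFun⟩

namespace Region

lemma inl_mem_boundarySet_sum {X Y : Region} {x : X.carrier} :
    (Sum.inl x : (X.sum Y).carrier) ∈ (X.sum Y).boundarySet ↔ x ∈ X.boundarySet := by
  constructor
  · rintro ⟨_, ⟨e, he, rfl⟩ | ⟨e, he, rfl⟩, ⟨y, hy, hyx⟩, h⟩
    · obtain rfl := Sum.inl_injective hyx
      exact ⟨e, he, hy, h⟩
    · simp at hyx
  · rintro ⟨e, he, hx, h⟩
    exact ⟨_, Or.inl ⟨e, he, rfl⟩, ⟨x, hx, rfl⟩, h⟩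

lemma inr_mem_boundarySet_sum {X Y : Region} {y : Y.carrier} :
    (Sum.inr y : (X.sum Y).carrier) ∈ (X.sum Y).boundarySet ↔ y ∈ Y.boundarySet := by
  constructor
  · rintro ⟨_, ⟨e, he, rfl⟩ | ⟨e, he, rfl⟩, ⟨z, hz, hzy⟩, h⟩
    · simp at hzy
    · obtain rfl := Sum.inr_injective hzy
      exact ⟨e, he, hz, h⟩
  · rintro ⟨e, he, hx, h⟩
    exact ⟨_, Or.inr ⟨e, he, rfl⟩, ⟨y, hx, rfl⟩, h⟩

lemma mem_boundarySet_rev {X : Region} {x : X.carrier} :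
    (x : X.rev.carrier) ∈ X.rev.boundarySet ↔ x ∈ X.boundarySet := by
  constructor
  · rintro ⟨_, ⟨e, he, rfl⟩, hx, h⟩
    exact ⟨e, he, hx, by simpa [LocalChart.post, HalfPlane.reflect] using h⟩
  · rintro ⟨e, he, hx, h⟩
    exact ⟨_, ⟨e, he, rfl⟩, hx, by simpa [LocalChart.post, HalfPlane.reflect] using h⟩

/-- The boundary of a disjoint union is the disjoint union of the boundaries, as spaces. -/
def boundarySumMap (X Y : Region) : X.boundarySet ⊕ Y.boundarySet → (X.sum Y).boundarySet :=
  Sum.elim (fun x => ⟨Sum.inl x.1, inl_mem_boundarySet_sum.2 x.2⟩)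
    fun y => ⟨Sum.inr y.1, inr_mem_boundarySet_sum.2 y.2⟩

lemma continuous_boundarySumMap (X Y : Region) : Continuous (boundarySumMap X Y) :=
  Continuous.sumElim
    (Continuous.subtype_mk (continuous_inl.comp continuous_subtype_val) _)
    (Continuous.subtype_mk (continuous_inr.comp continuous_subtype_val) _)

lemma bijective_boundarySumMap (X Y : Region) : Function.Bijective (boundarySumMap X Y) := by
  constructor
  · rintro (x | x) (y | y) h
    · exact congrArg Sum.inl (Subtype.ext (Sum.inl_injective (congrArg Subtype.val h)))
    · have := congrArg Subtype.val h
      simp [boundarySumMap] at this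
    · have := congrArg Subtype.val h
      simp [boundarySumMap] at this
    · exact congrArg Sum.inr (Subtype.ext (Sum.inr_injective (congrArg Subtype.val h)))
  · rintro ⟨x | x, hx⟩
    · exact ⟨Sum.inl ⟨x, inl_mem_boundarySet_sum.1 hx⟩, rfl⟩
    · exact ⟨Sum.inr ⟨x, inr_mem_boundarySet_sum.1 hx⟩, rfl⟩

/-- `boundarySumMap` as a homeomorphism. -/
noncomputable def boundarySumHomeo (X Y : Region) :
    (X.boundary.sum Y.boundary).carrier ≃ₜ (X.sum Y).boundary.carrier :=
  Continuous.homeoOfEquivCompactToT2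
    (f := (Equiv.ofBijective (boundarySumMap X Y) (bijective_boundarySumMap X Y) :
      (X.boundary.sum Y.boundary).carrier ≃ (X.sum Y).boundary.carrier))
    (continuous_boundarySumMap X Y)

/-- The identification of `∂X ⊔ ∂Y` with the boundary of `X ⊔ Y`. -/
noncomputable def boundarySum (X Y : Region) :
    HGluing (X.boundary.sum Y.boundary) (X.sum Y).boundary :=
  HGluing.ofHomeomorph (boundarySumHomeo X Y) <| by
    rintro _ (⟨_, ⟨e, he, rfl⟩, rfl⟩ | ⟨_, ⟨e, he, rfl⟩, rfl⟩) _ ⟨x, hx, rfl⟩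
    · exact ⟨_, ⟨_, Or.inl ⟨e, he, rfl⟩, rfl⟩, ⟨x.1, hx, rfl⟩, SameOrderAt.of_comp
        IsOpenEmbedding.inl (SameOrderAt.of_eqOn (X.boundaryChart e he).open_source hx
          fun y _ => rfl)⟩
    · exact ⟨_, ⟨_, Or.inr ⟨e, he, rfl⟩, rfl⟩, ⟨x.1, hx, rfl⟩, SameOrderAt.of_comp
        IsOpenEmbedding.inr (SameOrderAt.of_eqOn (Y.boundaryChart e he).open_source hx
          fun y _ => rfl)⟩

/-- The identification of the boundary with reversed orientation with the boundary of the region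
with reversed orientation. -/
noncomputable def boundaryRev (X : Region) : HGluing X.boundary.rev X.rev.boundary :=
  HGluing.ofHomeomorph
    ((Homeomorph.setCongr (Set.ext fun _ => mem_boundarySet_rev.symm) :
      X.boundarySet ≃ₜ X.rev.boundarySet) :
      X.boundary.rev.carrier ≃ₜ X.rev.boundary.carrier) <| by
    rintro _ ⟨_, ⟨e, he, rfl⟩, rfl⟩ x hx
    refine ⟨_, ⟨_, ⟨e, he, rfl⟩, rfl⟩, hx,
      SameOrderAt.of_eqOn (X.boundaryChart e he).open_source hx fun y _ => ?_⟩
    have h : unitInterval.sigmoid (-(e.toFun y.1).1.re) =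
        unitInterval.symm (unitInterval.sigmoid (e.toFun y.1).1.re) :=
      unitInterval.sigmoid_neg _
    have h2 : (-conj (e.toFun y.1).1).re = -(e.toFun y.1).1.re := by simp
    have h3 : unitInterval.symm (unitInterval.sigmoid (e.toFun y.1).1.re) =
        unitInterval.sigmoid (-conj (e.toFun y.1).1).re := by rw [h2, h]
    exact h3

end Region

/-! ## Slice regions and relative gluing diagrams -/

/-- `(S, s)` is a slice region for the hypersurface `M`: `S` is the cylinder `M × [0,1]`, pinched
along the boundary of `M` (each segment over a boundary point is collapsed to a point), and `s`
is given by the two faces, the one over `0` being the copy of `M` and the one over `1` being the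
copy of `M` with reversed orientation. The map `q` is the quotient map. -/
def IsSliceRegion (M : Hypersurface) (S : Region) (s : HGluing (M.rev.sum M) S.boundary) : Prop :=
  ∃ q : M.carrier × I → S.carrier, Continuous q ∧ Function.Surjective q ∧
    (∀ p p' t t', q (p, t) = q (p', t') ↔ p = p' ∧ (t = t' ∨ p ∉ M.interior)) ∧
    ∀ p : M.carrier, q (p, 0) = (s (Sum.inr p)).1 ∧ q (p, 1) = (s (Sum.inl p)).1

/-- A relative gluing diagram: a gluing function `f : X → X'` that glues `X` to itself along two
copies of `M` with opposite orientations in its boundary; `L` is the rest of the boundary. -/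
structure RelGluing (X X' : Region) (M L : Hypersurface) where
  α : HGluing ((M.sum M.rev).sum L) X.boundary
  f : RGluing X X'
  β : HGluing L X'.boundary
  /-- `f` coequalizes the two inclusions of `M`, and does so universally. -/
  coequalizes : ∀ p : M.carrier,
    f (α (Sum.inl (Sum.inl p))).1 = f (α (Sum.inl (Sum.inr p))).1
  universal : ∀ (T : Type) [TopologicalSpace T] (g : X.carrier → T), Continuous g →
    (∀ p : M.carrier, g (α (Sum.inl (Sum.inl p))).1 = g (α (Sum.inl (Sum.inr p))).1) →
    ∃! h : X'.carrier → T, Continuous h ∧ ∀ x, h (f x) = g x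
  comm : ∀ l : L.carrier, f (α (Sum.inr l)).1 = (β l).1

/-- A notion of admissibility. All hypersurfaces, all gluing functions of hypersurfaces and all
homeomorphisms between admissible regions are admissible; regions and relative gluing diagrams may
be restricted. A slice region is admissible if its region is. -/
structure Admissibility where
  reg : Region → Prop
  diag : ∀ {X X' : Region} {M L : Hypersurface}, RelGluing X X' M L → Prop
  reg_empty : reg Region.empty
  reg_rev : ∀ X, reg X → reg X.rev
  reg_sum : ∀ X Y, reg X → reg Y → reg (X.sum Y)
  reg_of_diag : ∀ {X X' : Region} {M L : Hypersurface} (D : RelGluing X X' M L), diag D →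
    reg X ∧ reg X'
  exists_slice : ∀ M : Hypersurface, ∃ (S : Region) (s : HGluing (M.rev.sum M) S.boundary),
    reg S ∧ IsSliceRegion M S s

/-! ## Krein superspaces -/

/-- The sign `(-1)^i` of `i : ZMod 2`. -/
def sgn (i : ZMod 2) : ℂ := if i = 0 then 1 else -1

/-- A complex Krein superspace, presented by a Hilbert space with two commuting self-adjoint
involutions: a fundamental symmetry `J` and the grading operator `parity`. The Hilbert inner product
only serves to define the topology; the inner product of the Krein space is `form` below. -/
structure KreinSuperspace where
  carrier : Type u
  [normedAddCommGroup : NormedAddCommGroup carrier]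
  [innerProductSpace : InnerProductSpace ℂ carrier]
  [complete : CompleteSpace carrier]
  J : carrier →L[ℂ] carrier
  parity : carrier →L[ℂ] carrier
  J_J : ∀ v, J (J v) = v
  parity_parity : ∀ v, parity (parity v) = v
  J_symm : ∀ v w, inner ℂ (J v) w = inner ℂ v (J w)
  parity_symm : ∀ v w, inner ℂ (parity v) w = inner ℂ v (parity w)
  J_parity : ∀ v, J (parity v) = parity (J v)

attribute [instance] KreinSuperspace.normedAddCommGroup KreinSuperspace.innerProductSpace
  KreinSuperspace.complete

instance : CoeSort KreinSuperspace.{u} (Type u) := ⟨KreinSuperspace.carrier⟩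

namespace KreinSuperspace

/-- The (indefinite, hermitian, non-degenerate) inner product, antilinear in the first argument. -/
noncomputable def form {H : KreinSuperspace.{u}} (v w : H) : ℂ := inner ℂ v (H.J w)

/-- The homogeneous part of degree `i`. -/
def deg (H : KreinSuperspace.{u}) (i : ZMod 2) : Submodule ℂ H where
  carrier := {v | H.parity v = sgn i • v}
  add_mem' := by
    intro v w hv hw
    simp only [Set.mem_ofPred_eq] at *
    rw [map_add, hv, hw, smul_add]
  zero_mem' := by simp
  smul_mem' := by
    intro c v hv
    simp only [Set.mem_ofPred_eq] at *
    rw [map_smul, hv, smul_comm]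

/-- A decomposition of the homogeneous parts of a Krein superspace into orthogonal positive-definite
(`s = 0`) and negative-definite (`s = 1`) closed subspaces `P i s`, which are complete with respect
to plus or minus the inner product. -/
structure Decomposition (H : KreinSuperspace.{u}) where
  P : ZMod 2 → ZMod 2 → Submodule ℂ H
  isClosed : ∀ i s, IsClosed (P i s : Set H)
  sup_eq : ∀ i, P i 0 ⊔ P i 1 = H.deg i
  orthogonal : ∀ i, ∀ v ∈ P i 0, ∀ w ∈ P i 1, form v w = 0
  definite : ∀ i s, ∃ c : ℝ, 0 < c ∧ ∀ v ∈ P i s, c * ‖v‖ ^ 2 ≤ (sgn s * form v v).re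

/-- The family `ζ` is an orthonormal basis of the Krein superspace adapted to the decomposition `D`;
the vector `ζ k` has degree `d k` and sign class `s k`. -/
structure IsOrthonormalBasis {H : KreinSuperspace.{u}} (D : H.Decomposition) {K : Type*}
    (ζ : K → H) (d s : K → ZMod 2) : Prop where
  mem : ∀ k, ζ k ∈ D.P (d k) (s k)
  form_self : ∀ k, form (ζ k) (ζ k) = sgn (s k)
  form_ne : ∀ k l, k ≠ l → form (ζ k) (ζ l) = 0
  total : ∀ i t, (Submodule.span ℂ {v | ∃ k, d k = i ∧ s k = t ∧ ζ k = v}).topologicalClosure =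
    D.P i t

end KreinSuperspace

open KreinSuperspace

/-! ## Compositional quantum field theories -/

/-- The data attached to hypersurfaces by a 2-dimensional CQFT: state spaces with dense subspaces,
graded involutions, graded tensor isomorphisms and graded gluing epimorphisms. -/
structure StateSpaces where
  /-- state spaces -/
  H : Hypersurface → KreinSuperspace.{u}
  /-- the dense subspaces on which amplitudes are defined -/
  dom : ∀ M, Submodule ℂ (H M)
  dense_dom : ∀ M, Dense (dom M : Set (H M))
  /-- the state space of the empty hypersurface is `ℂ` -/
  unit : H Hypersurface.empty ≃L[ℂ] ℂ
  unit_form : ∀ v w, form v w = conj (unit v) * unit w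
  unit_even : ∀ v, v ∈ (H Hypersurface.empty).deg 0
  /-- graded involution -/
  ι : ∀ M, H M ≃L⋆[ℂ] H M.rev
  ι_graded : ∀ M i, ∀ v ∈ (H M).deg i, ι M v ∈ (H M.rev).deg i
  ι_dom : ∀ M, ∀ v ∈ dom M, ι M v ∈ dom M.rev
  /-- graded tensor isomorphism, on the Hilbert space tensor product -/
  tensorIso : ∀ M N, UniformSpace.Completion (H M ⊗[ℂ] H N) ≃L[ℂ] H (M.sum N)
  tensor_graded : ∀ M N i j, ∀ v ∈ (H M).deg i, ∀ w ∈ (H N).deg j,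
    tensorIso M N ((v ⊗ₜ[ℂ] w : H M ⊗[ℂ] H N) : UniformSpace.Completion (H M ⊗[ℂ] H N)) ∈
      (H (M.sum N)).deg (i + j)
  tensor_dom : ∀ M N, ∀ v ∈ dom M, ∀ w ∈ dom N,
    tensorIso M N ((v ⊗ₜ[ℂ] w : H M ⊗[ℂ] H N) : UniformSpace.Completion (H M ⊗[ℂ] H N)) ∈
      dom (M.sum N)
  /-- graded gluing epimorphism -/
  γ : ∀ {M N}, HGluing M N → (H M →L[ℂ] H N)
  γ_graded : ∀ {M N} (f : HGluing M N) i, ∀ v ∈ (H M).deg i, γ f v ∈ (H N).deg i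
  γ_epi : ∀ {M N} (f : HGluing M N), DenseRange (γ f)
  γ_bijective : ∀ {M N} (f : HGluing M N), Function.Bijective f → Function.Bijective (γ f)
  γ_id : ∀ M v, γ (HGluing.id M) v = v
  γ_dom : ∀ {M N} (f : HGluing M N), ∀ v ∈ dom M, γ f v ∈ dom N
  ι_ι : ∀ M v, γ (HGluing.revRev M) (ι M.rev (ι M v)) = v

namespace StateSpaces

variable (Z : StateSpaces.{u})

/-- The image of `v ⊗ w` under the tensor isomorphism. -/
noncomputable def tens {M N : Hypersurface} (v : Z.H M) (w : Z.H N) : Z.H (M.sum N) :=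
  Z.tensorIso M N
    ((v ⊗ₜ[ℂ] w : Z.H M ⊗[ℂ] Z.H N) : UniformSpace.Completion (Z.H M ⊗[ℂ] Z.H N))

/-- The antilinear map obtained from a gluing function `f : M → rev M` by applying `γ f` and then
the involution from the state space of `rev M` to that of `M`. -/
noncomputable def realStructure {M : Hypersurface} (f : HGluing M M.rev) (v : Z.H M) : Z.H M :=
  Z.γ (HGluing.revRev M) (Z.ι M.rev (Z.γ f v))

end StateSpaces

/-- A 2-dimensional CQFT for a given notion of admissibility. The amplitude maps are defined on the
dense subspaces of the state spaces; they are only meaningful for admissible regions. -/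
structure Theory (A : Admissibility) extends StateSpaces.{u} where
  /-- graded amplitude map -/
  ρ : ∀ X : Region, dom X.boundary →ₗ[ℂ] ℂ
  ρ_graded : ∀ X, A.reg X → ∀ v : dom X.boundary, (v : H X.boundary) ∈ (H X.boundary).deg 1 →
    ρ X v = 0
  ρ_empty : ∀ (g : HGluing Hypersurface.empty Region.empty.boundary)
    (v : H Hypersurface.empty) (hv : v ∈ dom Hypersurface.empty),
    ρ Region.empty ⟨γ g v, γ_dom g v hv⟩ = unit v
  /-- associativity of the tensor isomorphism -/
  tens_assoc : ∀ {M N L : Hypersurface} (a : H M) (b : H N) (c : H L),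
    γ (HGluing.sumAssoc M N L) (toStateSpaces.tens (toStateSpaces.tens a b) c) =
      toStateSpaces.tens a (toStateSpaces.tens b c)
  /-- associativity of the gluing epimorphism -/
  γ_square : ∀ {M M₁ M₂ N : Hypersurface} (f₁ : HGluing M M₁) (g₁ : HGluing M₁ N)
    (f₂ : HGluing M M₂) (g₂ : HGluing M₂ N), (∀ x, g₁ (f₁ x) = g₂ (f₂ x)) →
    ∀ v, γ g₁ (γ f₁ v) = γ g₂ (γ f₂ v)
  /-- tensor and involution isomorphisms -/
  tens_ι : ∀ {M N : Hypersurface} (v : H M) (w : H N),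
    toStateSpaces.tens (ι M v) (ι N w) =
      γ (HGluing.revSum M N) (ι (N.sum M) (toStateSpaces.tens w v))
  /-- tensor isomorphism and gluing epimorphism -/
  tens_γ : ∀ {M M' N N' : Hypersurface} (f : HGluing M M') (g : HGluing N N') (v : H M) (w : H N),
    γ (f.sum g) (toStateSpaces.tens v w) = toStateSpaces.tens (γ f v) (γ g w)
  /-- gluing epimorphism and involution -/
  ι_γ : ∀ {M N : Hypersurface} (f : HGluing M N) (v : H M), ι N (γ f v) = γ f.rev (ι M v)
  /-- amplitude and tensor isomorphism -/
  ρ_sum : ∀ X Y, A.reg X → A.reg Y → ∀ (v : dom X.boundary) (w : dom Y.boundary),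
    ρ (X.sum Y) ⟨γ (Region.boundarySum X Y) (toStateSpaces.tens (v : H X.boundary)
      (w : H Y.boundary)), γ_dom _ _ (tensor_dom _ _ _ v.2 _ w.2)⟩ = ρ X v * ρ Y w
  /-- amplitude and involution -/
  ρ_rev : ∀ X, A.reg X → ∀ v : dom X.boundary,
    ρ X.rev ⟨γ (Region.boundaryRev X) (ι X.boundary v), γ_dom _ _ (ι_dom _ _ v.2)⟩ =
      conj (ρ X v)
  /-- amplitude and homeomorphism -/
  ρ_homeo : ∀ X X', A.reg X → A.reg X' → ∀ f : RGluing X X', Function.Bijective f →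
    ∀ g : HGluing X.boundary X'.boundary, (∀ x, (g x).1 = f x.1) →
    ∀ v : dom X.boundary, ρ X' ⟨γ g v, γ_dom g v v.2⟩ = ρ X v
  /-- evaluation and slice regions: the inner product is given by the amplitude of slice regions -/
  slice_mem : ∀ M S s, A.reg S → IsSliceRegion M S s → ∀ (v : H M.rev) (w : H M),
    γ s (toStateSpaces.tens v w) ∈ dom S.boundary
  slice : ∀ M S s (hS : A.reg S) (hs : IsSliceRegion M S s) (v w : H M),
    form v w = ρ S ⟨γ s (toStateSpaces.tens (ι M v) w), slice_mem M S s hS hs _ _⟩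
  /-- the gluing anomaly -/
  anomaly : ∀ {X X' M L}, RelGluing X X' M L → ℂ
  anomaly_ne_zero : ∀ {X X' M L} (D : RelGluing X X' M L), anomaly D ≠ 0
  /-- trivial gluing diagrams, given by homeomorphisms, have trivial anomaly -/
  anomaly_trivial : ∀ {X X' : Region} (D : RelGluing X X' Hypersurface.empty X.boundary),
    A.diag D → Function.Bijective D.f → (∀ x, D.α (Sum.inr x) = x) → anomaly D = 1
  gluing_mem : ∀ {X X' M L} (D : RelGluing X X' M L), A.diag D → ∀ ζ : H M, ∀ v ∈ dom L,
    γ D.α (toStateSpaces.tens (toStateSpaces.tens ζ (ι M ζ)) v) ∈ dom X.boundary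
  /-- amplitude and relative gluing diagrams -/
  gluing : ∀ {X X' M L} (D : RelGluing X X' M L) (hD : A.diag D) (B : (H M).Decomposition)
    {K : Type u} (ζ : K → H M) (d s : K → ZMod 2), IsOrthonormalBasis B ζ d s →
    ∀ (v : H L) (hv : v ∈ dom L),
    HasSum (fun k => anomaly D * (sgn (s k) *
      ρ X ⟨γ D.α (toStateSpaces.tens (toStateSpaces.tens (ζ k) (ι M (ζ k))) v),
        gluing_mem D hD (ζ k) v hv⟩))
      (ρ X' ⟨γ D.β v, γ_dom D.β v hv⟩)

/-- A CQFT is symmetric if the tensor isomorphisms intertwine the graded flip with the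
identification of `M ⊔ N` and `N ⊔ M`. -/
def Theory.IsSymmetric {A : Admissibility} (Z : Theory.{u} A) : Prop :=
  ∀ (M N : Hypersurface) (i j : ZMod 2), ∀ v ∈ (Z.H M).deg i, ∀ w ∈ (Z.H N).deg j,
    Z.γ (HGluing.sumSwap M N) (Z.tens v w) = sgn (i * j) • Z.tens w v

/-! ## Elementary gluing functions in dimension 2 -/

/-- The standard circle: the boundary of the standard disk. -/
noncomputable abbrev circle : Hypersurface := Region.disk.boundary

/-- A choice of the elementary gluing functions and special homeomorphisms: the gluing of two
intervals to one, the gluing of an interval to a circle, the twists of interval, circle and disk,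
and the half rotation of the circle. -/
structure ElementaryMaps where
  fII : HGluing (Hypersurface.interval.sum Hypersurface.interval) Hypersurface.interval
  fIC : HGluing Hypersurface.interval circle
  twistI : HGluing Hypersurface.interval Hypersurface.interval.rev
  twistC : HGluing circle circle.rev
  halfRot : HGluing circle circle
  twistD : RGluing Region.disk Region.disk.rev
  twistI_twistI : ∀ t, twistI (twistI t) = t
  twistI_fII : ∀ x, twistI (fII x) = fII (Sum.swap (Sum.map twistI twistI x))
  twistC_twistC : ∀ z, twistC (twistC z) = z
  twistC_fIC : ∀ t, twistC (fIC t) = fIC (twistI t)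
  halfRot_halfRot : ∀ z, halfRot (halfRot z) = z
  halfRot_fIC : ∀ x, halfRot (fIC (fII x)) = fIC (fII (Sum.swap x))
  halfRot_twistC : ∀ z, halfRot (twistC z) = twistC (halfRot z)
  twistD_twistD : ∀ z, twistD (twistD z) = z
  twistD_boundary : ∀ z : circle.carrier, twistD z.1 = (twistC z).1

end CQFT

open CQFT

/-!
The statement rests on two facts about the disk and one about Krein spaces.

*The disk is a slice region of the interval.* Gluing two intervals to one and the result to a circle
presents the circle as two arcs that meet exactly at their end points; this is forced by continuity,
injectivity on the interior and preservation of orientation (`ElementaryMaps.gluing_structure`,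
`path_eq_iff`). The twist of the interval exchanges its end points, so if the first interval is
precomposed with it, the two arcs are parametrized from one common end point to the other.
Such a pair of arcs is the image of the two standard half circles under a homeomorphism of the
circle. The standard half circles bound the family of vertical chords of the disk, which presents
the disk as a pinched cylinder, and the radial extension of the homeomorphism carries this
presentation to the given arcs (`isSliceRegion_disk`). The axiom on slice regions then gives the
formula for the inner product (`Theory.form_eq_disk`).

*The order of the two intervals is immaterial.* A gluing of two intervals remains one when they are
exchanged, so the disk is also a slice region with the two arcs in the other order. In a symmetric
theory the exchange of the two tensor factors costs the sign `(-1)^{|v||w|}`, and since the real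
structure `α` is an involution, comparing the two presentations gives
`⟨α v, α w⟩ = (-1)^{|v||w|} ⟨w, v⟩` (`Theory.isRealStructure`). The image of a decomposition under
`α` is therefore a decomposition, with signs flipped in degree one.

*An invariant decomposition exists.* Let `J` be a fundamental symmetry, `Π` the grading operator, and
let adjoints refer to the Hilbert inner product `⟨·, J ·⟩`. The formula above says that the adjoint
of `α` is `J Π α J`. Let `R` be the modulus of `α`, the positive square root of the product of the
adjoint of `α` with `α`. Uniqueness of positive square roots gives `α R α = R⁻¹ = J R J`
(`exists_modulus`). Hence `J R` is an involution; it is a fundamental symmetry since `J (J R) = R`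
is positive; and `(J R) α = Π α (J R)`, so that `α` permutes the eigenspaces of `J R` as claimed
(`IsRealStructure.exists_decomposition`).
-/

namespace CQFT

/-! ### Composition of gluing functions -/

namespace SameOrderAt

variable {M : Type} [TopologicalSpace M] {u v : M → I} {x : M}

lemma exists_lt_left (h : SameOrderAt u v x) (hu : ∃ᶠ y in 𝓝 x, u y < u x) :
    ∃ y, v y < v x := by
  have ht : Tendsto (fun y => (y, x)) (𝓝 x) (𝓝 (x, x)) :=
    (by fun_prop : Continuous fun y : M => (y, x)).tendsto' _ _ rfl
  obtain ⟨y, hy, hyx⟩ := (hu.and_eventually (ht.eventually h)).exists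
  exact ⟨y, hyx.1 hy⟩

lemma exists_lt_right (h : SameOrderAt u v x) (hu : ∃ᶠ y in 𝓝 x, u x < u y) :
    ∃ y, v x < v y := by
  have ht : Tendsto (fun y => (x, y)) (𝓝 x) (𝓝 (x, x)) :=
    (by fun_prop : Continuous fun y : M => (x, y)).tendsto' _ _ rfl
  obtain ⟨y, hy, hyx⟩ := (hu.and_eventually (ht.eventually h)).exists
  exact ⟨y, hyx.1 hy⟩

end SameOrderAt

lemma LocalChart.frequently {M E : Type} [TopologicalSpace M] [TopologicalSpace E]
    (e : LocalChart M E) {x : M} (hx : x ∈ e.source) {p : E → Prop}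
    (hp : ∃ᶠ t in 𝓝 (e.toFun x), p t) : ∃ᶠ y in 𝓝 x, p (e.toFun y) := by
  have h := e.isOpenEmbedding.map_nhds_eq ⟨x, hx⟩
  have h1 : ∃ᶠ y : e.source in 𝓝 ⟨x, hx⟩, p (e.toFun y) := by
    rw [← Filter.frequently_map (m := fun y : e.source => e.toFun y), h]
    exact hp
  exact (continuous_subtype_val.tendsto (⟨x, hx⟩ : e.source)).frequently h1

namespace HGluing

variable {M N L : Hypersurface}

/-- A gluing function maps the manifold interior to the manifold interior: being increasing in
charts near an interior point, it attains there neither the minimal nor the maximal value of a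
coordinate. -/
lemma map_mem_interior (f : HGluing M N) {x : M.carrier} (hx : x ∈ M.interior) :
    f x ∈ N.interior := by
  have hx' := hx
  obtain ⟨e, he, hxe, h0, h1⟩ := hx
  obtain ⟨e', he', hfx⟩ := N.cover (f x)
  have h := f.orientation x hx' e he hxe e' he' hfx
  have := nhdsLT_neBot_of_exists_lt ⟨_, h0⟩
  have := nhdsGT_neBot_of_exists_gt ⟨_, h1⟩
  obtain ⟨y, hy⟩ := h.exists_lt_left (e.frequently hxe (frequently_lt_nhds _))
  obtain ⟨z, hz⟩ := h.exists_lt_right (e.frequently hxe (frequently_gt_nhds _))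
  exact ⟨e', he', hfx, lt_of_le_of_lt unitInterval.nonneg' hy,
    lt_of_lt_of_le hz unitInterval.le_one'⟩

/-- The composition of two gluing functions. -/
def comp (g : HGluing N L) (f : HGluing M N) : HGluing M L where
  toFun := fun x => g (f x)
  continuous_toFun := g.continuous_toFun.comp f.continuous_toFun
  surjective_toFun := g.surjective_toFun.comp f.surjective_toFun
  isClosedMap_toFun := g.isClosedMap_toFun.comp f.isClosedMap_toFun
  isEmbedding_interior :=
    g.isEmbedding_interior.comp
      (f.isEmbedding_interior.codRestrict N.interior fun x => f.map_mem_interior x.2)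
  orientation := by
    intro x hx e he hxe e'' he'' hx''
    obtain ⟨e', he', hx'⟩ := N.cover (f x)
    exact (f.orientation x hx e he hxe e' he' hx').trans
      (SameOrderAt.comp f.continuous_toFun.continuousAt
        (g.orientation _ (f.map_mem_interior hx) e' he' hx' e'' he'' hx''))

/-- A twist of `M`, as a gluing function from the reversed hypersurface to `M`. -/
def untwist (f : HGluing M M.rev) : HGluing M.rev M :=
  (revRev M).comp f.rev

end HGluing

namespace Theory

variable {A : Admissibility} (Z : Theory.{u} A) {M N L : Hypersurface}

lemma γ_comp (g : HGluing N L) (f : HGluing M N) (v : Z.H M) :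
    Z.γ (g.comp f) v = Z.γ g (Z.γ f v) := by
  have := Z.γ_square (g.comp f) (HGluing.id L) f g (fun _ => rfl) v
  rwa [Z.γ_id] at this

lemma γ_eq_self (f : HGluing M M) (hf : ∀ x, f x = x) (v : Z.H M) : Z.γ f v = v := by
  rw [show f = HGluing.id M from HGluing.ext (funext hf), Z.γ_id]

/-! ### The real structure of a twist -/

lemma realStructure_eq (f : HGluing M M.rev) (v : Z.H M) :
    Z.realStructure f v = Z.γ f.untwist (Z.ι M v) := by
  rw [HGluing.untwist, γ_comp, StateSpaces.realStructure, Z.ι_γ]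

/-- The antilinear map given by a twist is an involution if the twist is one. -/
lemma realStructure_realStructure (f : HGluing M M.rev) (hf : ∀ x, f (f x) = x) (v : Z.H M) :
    Z.realStructure f (Z.realStructure f v) = v := by
  have h1 : ∀ w : Z.H M.rev,
      Z.γ (HGluing.revRev M).rev (Z.ι M.rev.rev (Z.ι M.rev w)) = w := by
    intro w
    have := Z.γ_square (HGluing.revRev M).rev (HGluing.id M.rev) (HGluing.revRev M.rev)
      (HGluing.id M.rev) (fun _ => rfl) (Z.ι M.rev.rev (Z.ι M.rev w))
    rw [Z.γ_id, Z.γ_id] at this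
    rw [this, Z.ι_ι]
  rw [realStructure_eq]
  conv_lhs => rw [StateSpaces.realStructure]
  rw [Z.ι_γ, h1, ← γ_comp]
  exact Z.γ_eq_self _ hf v

/-- The real structure of an involutive twist, as an antilinear homeomorphism. -/
noncomputable def realStructureEquiv (f : HGluing M M.rev) (hf : ∀ x, f (f x) = x) :
    Z.H M ≃L⋆[ℂ] Z.H M :=
  ContinuousLinearEquiv.equivOfInverse
    ((Z.γ f.untwist).comp (Z.ι M : Z.H M →L⋆[ℂ] Z.H M.rev))
    ((Z.γ f.untwist).comp (Z.ι M : Z.H M →L⋆[ℂ] Z.H M.rev))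
    (fun v => by
      have := Z.realStructure_realStructure f hf v
      rwa [realStructure_eq, realStructure_eq] at this)
    (fun v => by
      have := Z.realStructure_realStructure f hf v
      rwa [realStructure_eq, realStructure_eq] at this)

lemma realStructureEquiv_apply (f : HGluing M M.rev) (hf : ∀ x, f (f x) = x) (v : Z.H M) :
    Z.realStructureEquiv f hf v = Z.realStructure f v :=
  (Z.realStructure_eq f v).symm

lemma realStructure_mem_deg (f : HGluing M M.rev) {i : ZMod 2} {v : Z.H M}
    (hv : v ∈ (Z.H M).deg i) : Z.realStructure f v ∈ (Z.H M).deg i := by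
  rw [realStructure_eq]
  exact Z.γ_graded _ i _ (Z.ι_graded M i v hv)

end Theory

/-! ### Continuous maps of intervals -/

section Order

variable {α β : Type*} [LinearOrder α] [TopologicalSpace α] [OrderTopology α] [DenselyOrdered α]
  [LinearOrder β] [TopologicalSpace β] [OrderClosedTopology β]

lemma strictMonoOn_Icc_of_Ioo {f : α → β} {a b : α} (hf : ContinuousOn f (Set.Icc a b))
    (h : StrictMonoOn f (Set.Ioo a b)) : StrictMonoOn f (Set.Icc a b) := by
  have hl : ∀ p m, a ≤ p → p < m → m < b → f p ≤ f m := by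
    intro p m hap hpm hmb
    have hne : (𝓝[>] p).NeBot := nhdsGT_neBot_of_exists_gt ⟨m, hpm⟩
    have hc : ContinuousWithinAt f (Set.Ioo p m) p :=
      (hf p ⟨hap, (hpm.trans hmb).le⟩).mono fun y hy => ⟨hap.trans hy.1.le, (hy.2.trans hmb).le⟩
    have ht : Tendsto f (𝓝[>] p) (𝓝 (f p)) :=
      hc.mono_left (nhdsWithin_le_of_mem (Ioo_mem_nhdsGT hpm))
    refine le_of_tendsto ht ?_
    filter_upwards [Ioo_mem_nhdsGT hpm] with y hy
    exact (h ⟨hap.trans_lt hy.1, hy.2.trans hmb⟩ ⟨hap.trans_lt hpm, hmb⟩ hy.2).le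
  have hr : ∀ m q, a < m → m < q → q ≤ b → f m ≤ f q := by
    intro m q ham hmq hqb
    have hne : (𝓝[<] q).NeBot := nhdsLT_neBot_of_exists_lt ⟨m, hmq⟩
    have hc : ContinuousWithinAt f (Set.Ioo m q) q :=
      (hf q ⟨(ham.trans hmq).le, hqb⟩).mono fun y hy => ⟨(ham.trans hy.1).le, hy.2.le.trans hqb⟩
    have ht : Tendsto f (𝓝[<] q) (𝓝 (f q)) :=
      hc.mono_left (nhdsWithin_le_of_mem (Ioo_mem_nhdsLT hmq))
    refine ge_of_tendsto ht ?_
    filter_upwards [Ioo_mem_nhdsLT hmq] with y hy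
    exact (h ⟨ham, hmq.trans_le hqb⟩ ⟨ham.trans hy.1, hy.2.trans_le hqb⟩ hy.1).le
  intro p hp q hq hpq
  obtain ⟨m, hpm, hmq⟩ := exists_between hpq
  obtain ⟨m', hmm', hm'q⟩ := exists_between hmq
  have ham := hp.1.trans_lt hpm
  have hmb := hm'q.trans_le hq.2
  exact ((hl p m hp.1 hpm (hmm'.trans hmb)).trans_lt
    (h ⟨ham, hmm'.trans hmb⟩ ⟨ham.trans hmm', hmb⟩ hmm')).trans_le
    (hr m' q (ham.trans hmm') hm'q hq.2)

lemma strictAntiOn_Icc_of_Ioo {f : α → β} {a b : α} (hf : ContinuousOn f (Set.Icc a b))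
    (h : StrictAntiOn f (Set.Ioo a b)) : StrictAntiOn f (Set.Icc a b) :=
  strictMonoOn_Icc_of_Ioo (β := βᵒᵈ) hf h

end Order

/-- A continuous self-map of the unit interval that is injective on the interior and locally
increasing at an interior point is strictly increasing. -/
lemma strictMono_of_sameOrderAt {g : I → I} (hg : Continuous g) (hi : Set.InjOn g (Set.Ioo 0 1))
    {x : I} (hx : x ∈ Set.Ioo (0 : I) 1) (ho : SameOrderAt (fun y => y) g x) : StrictMono g := by
  have hon : StrictMonoOn g (Set.Ioo 0 1) := by
    refine (hg.continuousOn.strictMonoOn_of_injOn_Ioo zero_lt_one hi).resolve_right fun hanti => ?_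
    have hne : (𝓝[<] x).NeBot := nhdsLT_neBot_of_exists_lt ⟨_, hx.1⟩
    have ht : Tendsto (fun y => (y, x)) (𝓝 x) (𝓝 (x, x)) :=
      (by fun_prop : Continuous fun y : I => (y, x)).tendsto' _ _ rfl
    obtain ⟨y, hyx, hy, hy0⟩ := ((frequently_lt_nhds x).and_eventually
      ((ht.eventually ho).and (Ioi_mem_nhds hx.1))).exists
    exact lt_asymm (hy.1 hyx) (hanti ⟨hy0, hyx.trans hx.2⟩ hx hyx)
  have h := strictMonoOn_Icc_of_Ioo hg.continuousOn hon
  exact fun s t hst => h ⟨unitInterval.nonneg', unitInterval.le_one'⟩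
    ⟨unitInterval.nonneg', unitInterval.le_one'⟩ hst

/-- If two increasing paths in the unit interval cover it and do not overlap, then one of them runs
from `0` to the initial point of the other, which ends at `1`. -/
lemma endpoints_of_cover {l r : I → I} (hl : Continuous l) (hr : Continuous r) (hlm : StrictMono l)
    (hrm : StrictMono r)
    (hdisj : ∀ u ∈ Set.Ioo (0 : I) 1, ∀ p ∈ Set.Ioo (0 : I) 1, l u ≠ r p)
    (hcov : ∀ z, (∃ u, l u = z) ∨ ∃ p, r p = z) :
    (l 1 = r 0 ∧ l 0 = 0 ∧ r 1 = 1) ∨ (r 1 = l 0 ∧ r 0 = 0 ∧ l 1 = 1) := by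
  have key : ∀ {l r : I → I}, StrictMono l → StrictMono r →
      (∀ z, (∃ u, l u = z) ∨ ∃ p, r p = z) → l 1 ≤ r 0 → l 1 = r 0 ∧ l 0 = 0 ∧ r 1 = 1 := by
    intro l r hlm hrm hcov hle
    have hl01 := hlm zero_lt_one
    have hr01 := hrm zero_lt_one
    have hl0 : ∀ u, l 0 ≤ l u := fun u => hlm.monotone unitInterval.nonneg'
    have hr0 : ∀ u, r 0 ≤ r u := fun u => hrm.monotone unitInterval.nonneg'
    have hl1 : ∀ u, l u ≤ l 1 := fun u => hlm.monotone unitInterval.le_one'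
    have hr1 : ∀ u, r u ≤ r 1 := fun u => hrm.monotone unitInterval.le_one'
    refine ⟨?_, ?_, ?_⟩
    · by_contra hne
      obtain ⟨z, hz1, hz2⟩ := exists_between (lt_of_le_of_ne hle hne)
      rcases hcov z with ⟨u, rfl⟩ | ⟨u, rfl⟩
      · exact absurd (hl1 u) (not_le.2 hz1)
      · exact absurd (hr0 u) (not_le.2 hz2)
    · refine le_antisymm ?_ unitInterval.nonneg'
      rcases hcov 0 with ⟨u, hu⟩ | ⟨u, hu⟩
      · exact hu ▸ hl0 u
      · exact hu ▸ (hl01.le.trans hle).trans (hr0 u)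
    · refine le_antisymm unitInterval.le_one' ?_
      rcases hcov 1 with ⟨u, hu⟩ | ⟨u, hu⟩
      · exact hu.ge.trans (((hl1 u).trans hle).trans hr01.le)
      · exact hu ▸ hr1 u
  have hsep : l 1 ≤ r 0 ∨ r 1 ≤ l 0 := by
    by_contra! h
    have hlt : max (l 0) (r 0) < min (l 1) (r 1) :=
      lt_min (max_lt (hlm zero_lt_one) h.1) (max_lt h.2 (hrm zero_lt_one))
    obtain ⟨z, hz1, hz2⟩ := exists_between hlt
    rw [max_lt_iff] at hz1
    rw [lt_min_iff] at hz2
    obtain ⟨u, hu, hu'⟩ := intermediate_value_Ioo zero_le_one hl.continuousOn ⟨hz1.1, hz2.1⟩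
    obtain ⟨p, hp, hp'⟩ := intermediate_value_Ioo zero_le_one hr.continuousOn ⟨hz1.2, hz2.2⟩
    exact hdisj u hu p hp (hu'.trans hp'.symm)
  exact hsep.imp (key hlm hrm hcov) (key hrm hlm fun z => (hcov z).symm)

/-! ### Paths in the unit circle -/

/-- A path in the unit circle that misses a point and is injective on the interior has distinct
end points. -/
lemma path_ne_of_avoid {F : I → ℂ} (hF : Continuous F) (hn : ∀ t, ‖F t‖ = 1) {a b : I} (hab : a < b)
    (hi : Set.InjOn F (Set.Ioo a b)) {P : ℂ} (hP : ‖P‖ = 1) (hne : ∀ t ∈ Set.Icc a b, F t ≠ P) :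
    F a ≠ F b := by
  have hP0 : P ≠ 0 := norm_ne_zero_iff.1 (by rw [hP]; exact one_ne_zero)
  have hnorm : ∀ t, ‖-F t / P‖ = 1 := fun t => by rw [norm_div, norm_neg, hn, hP, div_one]
  -- the angle between `F t` and the antipode of `P`
  let g : I → ℝ := fun t => (-F t / P).arg
  have hexp : ∀ t, Complex.exp (g t * Complex.I) = -F t / P := fun t => by
    have := Complex.norm_mul_exp_arg_mul_I (-F t / P)
    rwa [hnorm, Complex.ofReal_one, one_mul] at this
  have hgF : ∀ s t, g s = g t → F s = F t := by
    intro s t h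
    have h1 := hexp s
    rw [h, hexp t] at h1
    field_simp at h1
    exact (neg_injective h1).symm
  have hslit : ∀ t ∈ Set.Icc a b, -F t / P ∈ Complex.slitPlane := by
    intro t ht
    rw [Complex.mem_slitPlane_iff_arg]
    refine ⟨fun h => hne t ht ?_, norm_ne_zero_iff.1 (by rw [hnorm]; exact one_ne_zero)⟩
    have h1 := hexp t
    rw [show g t = Real.pi from h, Complex.exp_pi_mul_I] at h1
    field_simp at h1
    exact (neg_injective h1).symm
  have hg : ContinuousOn g (Set.Icc a b) := fun t ht =>
    ((Complex.continuousAt_arg (hslit t ht)).comp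
      (f := fun t => -F t / P) (by fun_prop)).continuousWithinAt
  have hgi : Set.InjOn g (Set.Ioo a b) := fun s hs t ht h => hi hs ht (hgF s t h)
  intro h
  have hg0 : g a = g b := by simp only [g, h]
  rcases (hg.mono Set.Ioo_subset_Icc_self).strictMonoOn_of_injOn_Ioo hab hgi with h1 | h1
  · exact (strictMonoOn_Icc_of_Ioo hg h1 (Set.left_mem_Icc.2 hab.le)
      (Set.right_mem_Icc.2 hab.le) hab).ne hg0
  · exact (strictAntiOn_Icc_of_Ioo hg h1 (Set.left_mem_Icc.2 hab.le)
      (Set.right_mem_Icc.2 hab.le) hab).ne hg0.symm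

/-- There is no continuous bijection from the unit interval to the unit circle: its inverse would
take equal values at some pair of antipodal points. -/
lemma not_bijective_path (F : I → Metric.sphere (0 : ℂ) 1) (hF : Continuous F) :
    ¬ Function.Bijective F := by
  intro hbij
  let Φ : I ≃ₜ Metric.sphere (0 : ℂ) 1 :=
    Continuous.homeoOfEquivCompactToT2 (f := Equiv.ofBijective F hbij) hF
  have : PreconnectedSpace (Metric.sphere (0 : ℂ) 1) :=
    isPreconnected_iff_preconnectedSpace.1
      (isPreconnected_sphere (by rw [Complex.rank_real_complex]; norm_num) 0 1)
  let h : Metric.sphere (0 : ℂ) 1 → ℝ := fun z => (Φ.symm z : ℝ) - (Φ.symm (-z) : ℝ)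
  have hc : Continuous h := by fun_prop
  have hodd : ∀ z, h (-z) = -h z := fun z => by simp only [h, neg_neg]; ring
  have hz0 : ∃ z, h z = 0 := by
    let z₀ : Metric.sphere (0 : ℂ) 1 := ⟨1, by simp⟩
    rcases le_total (h z₀) 0 with h0 | h0
    · exact mem_range_of_exists_le_of_exists_ge hc ⟨z₀, h0⟩ ⟨-z₀, by rw [hodd]; linarith⟩
    · exact mem_range_of_exists_le_of_exists_ge hc ⟨-z₀, by rw [hodd]; linarith⟩ ⟨z₀, h0⟩
  obtain ⟨z, hz⟩ := hz0
  have h1 : Φ.symm z = Φ.symm (-z) := Subtype.ext (sub_eq_zero.1 hz)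
  have h2 : z.1 = -z.1 := congrArg Subtype.val (Φ.symm.injective h1)
  have h3 : z.1 = 0 := by linear_combination h2 / 2
  have h4 := z.2
  rw [h3] at h4
  simp at h4

/-- A closed path that covers the unit circle and is injective on the interior identifies exactly
the end points. -/
lemma path_eq_iff {F : I → Metric.sphere (0 : ℂ) 1} (hF : Continuous F)
    (hsurj : Function.Surjective F) (hi : Set.InjOn F (Set.Ioo 0 1)) {s t : I} (hst : s < t) :
    F s = F t ↔ s = 0 ∧ t = 1 := by
  have hG : Continuous fun t => (F t : ℂ) := continuous_subtype_val.comp hF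
  have hn : ∀ t, ‖(F t : ℂ)‖ = 1 := fun t => mem_sphere_zero_iff_norm.1 (F t).2
  have h0 : ∀ x ∈ Set.Ioo (0 : I) 1, F 0 ≠ F x := by
    intro x hx h
    -- the loop from `0` to `x` misses the points passed after `x`
    obtain ⟨y, hxy, hy1⟩ := exists_between hx.2
    have hy : y ∈ Set.Ioo (0 : I) 1 := ⟨hx.1.trans hxy, hy1⟩
    refine path_ne_of_avoid hG hn hx.1 (fun u hu v hv huv => hi ⟨hu.1, hu.2.trans hx.2⟩
      ⟨hv.1, hv.2.trans hx.2⟩ (Subtype.ext huv)) (hn y) (fun u hu huy => ?_)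
      (congrArg Subtype.val h)
    rcases hu.1.eq_or_lt with rfl | hu0
    · exact hxy.ne (hi hx hy (h.symm.trans (Subtype.ext huy)))
    · exact (hu.2.trans_lt hxy).ne (hi ⟨hu0, hu.2.trans_lt hx.2⟩ hy (Subtype.ext huy))
  have h1 : ∀ x ∈ Set.Ioo (0 : I) 1, F x ≠ F 1 := by
    intro x hx h
    obtain ⟨y, hy0, hyx⟩ := exists_between hx.1
    have hy : y ∈ Set.Ioo (0 : I) 1 := ⟨hy0, hyx.trans hx.2⟩
    refine path_ne_of_avoid hG hn hx.2 (fun u hu v hv huv => hi ⟨hx.1.trans hu.1, hu.2⟩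
      ⟨hx.1.trans hv.1, hv.2⟩ (Subtype.ext huv)) (hn y) (fun u hu huy => ?_)
      (congrArg Subtype.val h)
    rcases hu.2.eq_or_lt with rfl | hu1
    · exact hyx.ne (hi hy hx ((Subtype.ext huy).symm.trans h.symm))
    · exact (hyx.trans_le hu.1).ne (hi hy ⟨hx.1.trans_le hu.1, hu1⟩ (Subtype.ext huy.symm))
  have hinj : ∀ s t : I, s < t → F s = F t → s = 0 ∧ t = 1 := by
    intro s t hst h
    rcases (unitInterval.nonneg' (t := s)).eq_or_lt with rfl | hs0
    · refine ⟨rfl, ?_⟩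
      by_contra ht
      exact h0 t ⟨hst, lt_of_le_of_ne unitInterval.le_one' ht⟩ h
    · exfalso
      have hs : s ∈ Set.Ioo (0 : I) 1 := ⟨hs0, hst.trans_le unitInterval.le_one'⟩
      rcases (unitInterval.le_one' (t := t)).eq_or_lt with rfl | ht1
      · exact h1 s hs h
      · exact hst.ne (hi hs ⟨hs0.trans hst, ht1⟩ h)
  refine ⟨hinj s t hst, ?_⟩
  rintro ⟨rfl, rfl⟩
  by_contra hne
  refine not_bijective_path F hF ⟨fun s t h => ?_, hsurj⟩
  rcases lt_trichotomy s t with hst | rfl | hst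
  · obtain ⟨rfl, rfl⟩ := hinj s t hst h
    exact absurd h hne
  · rfl
  · obtain ⟨rfl, rfl⟩ := hinj t s hst h.symm
    exact absurd h.symm hne

/-! ### Radial extension to the disk -/

/-- The radial extension of a self-map of the unit circle to the complex plane. -/
noncomputable def radial (φ : Metric.sphere (0 : ℂ) 1 → Metric.sphere (0 : ℂ) 1) (z : ℂ) : ℂ :=
  if h : z = 0 then 0 else ‖z‖ * (φ ⟨z / ‖z‖, by simp [h]⟩ : ℂ)

section Radial

variable {φ : Metric.sphere (0 : ℂ) 1 → Metric.sphere (0 : ℂ) 1}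

lemma radial_of_ne {z : ℂ} (h : z ≠ 0) :
    radial φ z = ‖z‖ * (φ ⟨z / ‖z‖, by simp [h]⟩ : ℂ) := dif_neg h

lemma norm_radial (z : ℂ) : ‖radial φ z‖ = ‖z‖ := by
  by_cases h : z = 0
  · simp [radial, h]
  · have h1 := mem_sphere_zero_iff_norm.1 (φ ⟨z / ‖z‖, by simp [h]⟩).2
    rw [radial_of_ne h, norm_mul, h1, mul_one, Complex.norm_real, norm_norm]

lemma radial_coe (z : Metric.sphere (0 : ℂ) 1) : radial φ z = φ z := by
  have hz := mem_sphere_zero_iff_norm.1 z.2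
  have h : (z : ℂ) ≠ 0 := norm_ne_zero_iff.1 (by rw [hz]; exact one_ne_zero)
  rw [radial_of_ne h]
  simp [hz]

lemma continuous_radial (hφ : Continuous φ) : Continuous (radial φ) := by
  rw [continuous_iff_continuousAt]
  intro z
  by_cases h : z = 0
  · subst h
    have h0 : radial φ 0 = 0 := dif_pos rfl
    rw [ContinuousAt, h0]
    refine squeeze_zero_norm (fun z => (norm_radial z).le) ?_
    exact continuous_norm.tendsto' 0 0 norm_zero
  · have hon : ContinuousOn (radial φ) {0}ᶜ := by
      rw [continuousOn_iff_continuous_domRestrict]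
      have heq : Set.domRestrict {0}ᶜ (radial φ) = fun z : ({0}ᶜ : Set ℂ) => ((‖z.1‖ : ℝ) : ℂ) *
          (φ ⟨z.1 / ‖z.1‖, by simp [show z.1 ≠ 0 from z.2]⟩ : ℂ) :=
        funext fun z => radial_of_ne z.2
      rw [heq]
      have hdiv : Continuous fun z : ({0}ᶜ : Set ℂ) => z.1 / ((‖z.1‖ : ℝ) : ℂ) :=
        Continuous.div (by fun_prop) (by fun_prop) fun z => by simp [show z.1 ≠ 0 from z.2]
      exact (by fun_prop : Continuous fun z : ({0}ᶜ : Set ℂ) => ((‖z.1‖ : ℝ) : ℂ)).mul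
        (continuous_subtype_val.comp (hφ.comp (hdiv.subtype_mk _)))
    exact hon.continuousAt (isOpen_compl_singleton.mem_nhds h)

lemma injective_radial (hφ : Function.Injective φ) : Function.Injective (radial φ) := by
  intro z w h
  have hn : ‖z‖ = ‖w‖ := by rw [← norm_radial (φ := φ) z, h, norm_radial]
  by_cases hz : z = 0
  · subst hz
    rw [norm_zero] at hn
    exact (norm_eq_zero.1 hn.symm).symm
  · have hw : w ≠ 0 := norm_ne_zero_iff.1 (hn ▸ norm_ne_zero_iff.2 hz)
    have hn0 : ((‖w‖ : ℝ) : ℂ) ≠ 0 := by simpa using hw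
    rw [radial_of_ne hz, radial_of_ne hw] at h
    simp only [hn] at h
    have h1 : z / (‖w‖ : ℂ) = w / ‖w‖ :=
      congrArg Subtype.val (hφ (Subtype.ext (mul_left_cancel₀ hn0 h)))
    exact (div_left_inj' hn0).1 h1

lemma surjective_radial (hφ : Function.Surjective φ) : Function.Surjective (radial φ) := by
  intro w
  by_cases hw : w = 0
  · exact ⟨0, by simp [radial, hw]⟩
  · have hn0 : ((‖w‖ : ℝ) : ℂ) ≠ 0 := by simpa using hw
    obtain ⟨u, hu⟩ := hφ ⟨w / ‖w‖, by simp [hw]⟩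
    have hun := mem_sphere_zero_iff_norm.1 u.2
    have hu0 : (u : ℂ) ≠ 0 := norm_ne_zero_iff.1 (by rw [hun]; exact one_ne_zero)
    have hz : (‖w‖ : ℂ) * u ≠ 0 := mul_ne_zero hn0 hu0
    refine ⟨‖w‖ * u, ?_⟩
    rw [radial_of_ne hz]
    have h1 : ‖(‖w‖ : ℂ) * u‖ = ‖w‖ := by rw [norm_mul, hun, mul_one, Complex.norm_real, norm_norm]
    have h2 : (⟨(‖w‖ : ℂ) * u / ‖(‖w‖ : ℂ) * u‖, by simp [hun, hw]⟩ : Metric.sphere (0 : ℂ) 1) = u := by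
      apply Subtype.ext
      simp only [h1]
      field_simp
    rw [h2, hu, h1]
    show (‖w‖ : ℂ) * (w / ‖w‖) = w
    field_simp

end Radial

/-! ### The disk as a slice region of the interval -/

/-- The disk as a pinched cylinder: the segment over `p` is the vertical chord at abscissa
`2 p - 1`, traversed downwards. -/
noncomputable def lens (x : I × I) : ℂ :=
  ⟨2 * x.1 - 1, (1 - 2 * x.2) * (2 * √(x.1 * (1 - x.1)))⟩

lemma continuous_lens : Continuous lens := by
  have h : Continuous fun x : I × I => ((2 * (x.1 : ℝ) - 1 : ℝ) : ℂ) +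
      ((1 - 2 * (x.2 : ℝ)) * (2 * √(x.1 * (1 - x.1))) : ℝ) * Complex.I := by
    fun_prop
  exact h.congr fun x => (Complex.mk_eq_add_mul_I _ _).symm

lemma sq_lens (x : I × I) : ‖lens x‖ ^ 2 = 1 - 4 * (x.1 * (1 - x.1)) * (1 - (1 - 2 * x.2) ^ 2) := by
  have h : √((x.1 : ℝ) * (1 - x.1)) ^ 2 = x.1 * (1 - x.1) :=
    Real.sq_sqrt (mul_nonneg x.1.2.1 (sub_nonneg.2 x.1.2.2))
  rw [← Complex.normSq_eq_norm_sq, Complex.normSq_apply]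
  simp only [lens]
  linear_combination 4 * (1 - 2 * (x.2 : ℝ)) ^ 2 * h

lemma norm_lens_le (x : I × I) : ‖lens x‖ ≤ 1 := by
  rw [← sq_le_one_iff₀ (norm_nonneg _), sq_lens]
  have h1 := mul_nonneg x.1.2.1 (sub_nonneg.2 x.1.2.2)
  have h2 := mul_nonneg x.2.2.1 (sub_nonneg.2 x.2.2.2)
  nlinarith [mul_nonneg h1 h2]

lemma norm_lens_zero (p : I) : ‖lens (p, 0)‖ = 1 := by
  rw [← pow_eq_one_iff_of_nonneg (norm_nonneg _) two_ne_zero, sq_lens]; simp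

lemma norm_lens_one (p : I) : ‖lens (p, 1)‖ = 1 := by
  rw [← pow_eq_one_iff_of_nonneg (norm_nonneg _) two_ne_zero, sq_lens]; norm_num

lemma lens_eq_iff {p p' t t' : I} :
    lens (p, t) = lens (p', t') ↔ p = p' ∧ (t = t' ∨ ¬ (0 < p ∧ p < 1)) := by
  have hw : √((p : ℝ) * (1 - p)) = 0 ↔ ¬ (0 < p ∧ p < 1) := by
    rw [Real.sqrt_eq_zero (mul_nonneg p.2.1 (sub_nonneg.2 p.2.2)), mul_eq_zero, sub_eq_zero]
    rw [unitInterval.pos_iff_ne_zero, unitInterval.lt_one_iff_ne_one, not_and_or, not_not, not_not]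
    refine or_congr ⟨fun h => Subtype.ext h, fun h => by rw [h]; rfl⟩
      ⟨fun h => Subtype.ext h.symm, fun h => by rw [h]; rfl⟩
  constructor
  · intro h
    have hre : (2 * p - 1 : ℝ) = 2 * p' - 1 := congrArg Complex.re h
    have him : (1 - 2 * (t : ℝ)) * (2 * √((p : ℝ) * (1 - p))) =
      (1 - 2 * (t' : ℝ)) * (2 * √((p' : ℝ) * (1 - p'))) := congrArg Complex.im h
    obtain rfl : p = p' := Subtype.ext (by linarith)
    refine ⟨rfl, ?_⟩
    rw [← hw]
    have h1 : ((t' : ℝ) - t) * √((p : ℝ) * (1 - p)) = 0 := by linear_combination him / 4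
    refine (mul_eq_zero.1 h1).imp (fun h2 => Subtype.ext (by linarith)) fun h2 => h2
  · rintro ⟨rfl, rfl | h⟩
    · rfl
    · simp only [lens, hw.2 h, mul_zero]

lemma exists_lens {z : ℂ} (hz : ‖z‖ ≤ 1) : ∃ x, lens x = z := by
  have h1 : z.re ^ 2 + z.im ^ 2 ≤ 1 := by
    have h := (sq_le_one_iff₀ (norm_nonneg z)).2 hz
    rw [← Complex.normSq_eq_norm_sq, Complex.normSq_apply] at h
    linarith
  have hre : |z.re| ≤ 1 := abs_le_one_iff_mul_self_le_one.2 (by nlinarith [sq_nonneg z.im])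
  rw [abs_le] at hre
  let p : I := ⟨(z.re + 1) / 2, by constructor <;> linarith [hre.1, hre.2]⟩
  have hp : (p : ℝ) = (z.re + 1) / 2 := rfl
  set w : ℝ := 2 * √((p : ℝ) * (1 - p)) with hw
  have hw2 : w ^ 2 = 1 - z.re ^ 2 := by
    rw [hw, mul_pow, Real.sq_sqrt (mul_nonneg p.2.1 (sub_nonneg.2 p.2.2)), hp]
    ring
  have hw0 : 0 ≤ w := by positivity
  have him : |z.im| ≤ w := abs_le_of_sq_le_sq (by linarith) hw0
  rw [abs_le] at him
  rcases hw0.eq_or_lt with h0 | h0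
  · refine ⟨(p, 0), Complex.ext ?_ ?_⟩
    · show 2 * (p : ℝ) - 1 = z.re
      rw [hp]; ring
    · show (1 - 2 * ((0 : I) : ℝ)) * w = z.im
      rw [← h0] at him ⊢
      linarith [him.1, him.2]
  · let t : I := ⟨(1 - z.im / w) / 2, by
      have h2 : z.im / w ≤ 1 := (div_le_one h0).2 him.2
      have h3 : -1 ≤ z.im / w := (le_div_iff₀ h0).2 (by linarith [him.1])
      constructor <;> linarith⟩
    refine ⟨(p, t), Complex.ext ?_ ?_⟩
    · show 2 * (p : ℝ) - 1 = z.re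
      rw [hp]; ring
    · show (1 - 2 * ((1 - z.im / w) / 2)) * w = z.im
      field_simp
      ring

lemma mem_boundarySet_disk {z : Disk} :
    (z : Region.disk.carrier) ∈ Region.disk.boundarySet ↔ ‖z.1‖ = 1 := by
  have key : ∀ z : Disk, z.1 ≠ 1 → ((Disk.cayley z).1.im = 0 ↔ ‖z.1‖ = 1) := by
    intro z hz
    have hz' := Disk.one_sub_ne_zero hz
    have h0 : Complex.normSq (1 - z.1) ≠ 0 := by simpa using hz'
    have h : (Disk.cayley z).1.im * Complex.normSq (1 - z.1) = 1 - ‖z.1‖ ^ 2 := by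
      simp only [Disk.cayley]
      rw [Complex.div_im, ← Complex.normSq_eq_norm_sq, Complex.normSq_apply z.1]
      field_simp
      simp
      ring
    rw [← pow_eq_one_iff_of_nonneg (norm_nonneg z.1) two_ne_zero]
    constructor
    · intro h1
      rw [h1] at h
      linarith
    · intro h1
      rw [h1, sub_self] at h
      exact (mul_eq_zero.1 h).resolve_right h0
  by_cases hz : z.1 = 1
  · have hs : z ∈ Disk.chartNeg.source := Disk.mem_source_chartNeg.2 (by
      show -z.1 ≠ 1
      rw [hz]; norm_num)
    refine (Region.mem_boundarySet_iff Region.disk (e := Disk.chartNeg) (Or.inr rfl) hs).trans ?_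
    have := key (Disk.neg z) (Disk.mem_source_chartNeg.1 hs)
    rw [show (Disk.neg z).1 = -z.1 from rfl, norm_neg] at this
    exact this
  · exact (Region.mem_boundarySet_iff Region.disk (e := Disk.chart) (Or.inl rfl) hz).trans (key z hz)

/-- The boundary of the standard disk is the unit circle. -/
noncomputable def circleHomeo : circle.carrier ≃ₜ Metric.sphere (0 : ℂ) 1 where
  toFun z := ⟨z.1.1, mem_sphere_zero_iff_norm.2 (mem_boundarySet_disk.1 z.2)⟩
  invFun z := ⟨⟨z.1, Metric.sphere_subset_closedBall z.2⟩,
    mem_boundarySet_disk.2 (mem_sphere_zero_iff_norm.1 z.2)⟩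
  left_inv _ := rfl
  right_inv _ := rfl
  continuous_toFun := by
    have h1 : Continuous fun z : Region.disk.boundarySet => z.1 := continuous_subtype_val
    have h2 : Continuous fun z : Disk => z.1 := continuous_subtype_val
    exact (h2.comp h1).subtype_mk _
  continuous_invFun := by
    have h : Continuous (Y := Region.disk.carrier) fun z : Metric.sphere (0 : ℂ) 1 =>
        (⟨z.1, Metric.sphere_subset_closedBall z.2⟩ : Disk) :=
      Continuous.subtype_mk (p := fun w : ℂ => w ∈ Metric.closedBall 0 1) continuous_subtype_val _
    exact h.subtype_mk _

lemma mem_interior_interval {p : I} :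
    (p : Hypersurface.interval.carrier) ∈ Hypersurface.interval.interior ↔ 0 < p ∧ p < 1 := by
  constructor
  · rintro ⟨_, rfl, -, h⟩
    exact h
  · exact fun h => ⟨_, rfl, Set.mem_univ _, h⟩

/-- Two arcs that cover the circle and meet exactly at their end points are the faces of a pinched
cylinder, namely the disk: the arcs are carried to the standard half circles by a homeomorphism of
the circle, and its radial extension carries the disk to itself. -/
lemma isSliceRegion_disk
    (s : HGluing (Hypersurface.interval.rev.sum Hypersurface.interval) circle)
    (hr : ∀ p p' : I, s (Sum.inr p) = s (Sum.inr p') → p = p')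
    (hl : ∀ p p' : I, s (Sum.inl p) = s (Sum.inl p') → p = p')
    (hlr : ∀ p p' : I, s (Sum.inl p) = s (Sum.inr p') ↔ p = p' ∧ ¬ (0 < p ∧ p < 1)) :
    IsSliceRegion Hypersurface.interval Region.disk s := by
  let S := Metric.sphere (0 : ℂ) 1
  let std : I ⊕ I → S := Sum.elim
    (fun p => ⟨lens (p, 1), mem_sphere_zero_iff_norm.2 (norm_lens_one p)⟩)
    (fun p => ⟨lens (p, 0), mem_sphere_zero_iff_norm.2 (norm_lens_zero p)⟩)
  have hstd : Continuous std := Continuous.sumElim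
    (Continuous.subtype_mk (continuous_lens.comp (by fun_prop)) _)
    (Continuous.subtype_mk (continuous_lens.comp (by fun_prop)) _)
  have hstds : Function.Surjective std := by
    intro z
    have hz := mem_sphere_zero_iff_norm.1 z.2
    obtain ⟨⟨p, t⟩, hx⟩ := exists_lens hz.le
    have h1 := sq_lens (p, t)
    rw [hx, hz] at h1
    have h2 : 16 * ((p : ℝ) * (1 - p)) * (t * (1 - t)) = 0 := by linear_combination h1
    rcases mul_eq_zero.1 h2 with h3 | h3
    · refine ⟨Sum.inl p, Subtype.ext (Eq.trans (lens_eq_iff.2 ⟨rfl, Or.inr ?_⟩) hx)⟩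
      rintro ⟨h4, h5⟩
      have h6 : (0 : ℝ) < p := h4
      have h7 : (p : ℝ) < 1 := h5
      have := mul_pos h6 (sub_pos.2 h7)
      linarith
    · rcases mul_eq_zero.1 h3 with h4 | h4
      · obtain rfl : t = 0 := Subtype.ext h4
        exact ⟨Sum.inr p, Subtype.ext hx⟩
      · obtain rfl : t = 1 := Subtype.ext (sub_eq_zero.1 h4).symm
        exact ⟨Sum.inl p, Subtype.ext hx⟩
  let G : I ⊕ I → S := fun x => circleHomeo (s x)
  have hG : Continuous G := circleHomeo.continuous.comp s.continuous_toFun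
  have hGs : Function.Surjective G := circleHomeo.surjective.comp s.surjective_toFun
  have hGi : ∀ x y, G x = G y ↔ s x = s y := fun x y => circleHomeo.injective.eq_iff
  have hstdlr : ∀ p p' : I, std (Sum.inl p) = std (Sum.inr p') ↔ p = p' ∧ ¬ (0 < p ∧ p < 1) := by
    intro p p'
    rw [Subtype.ext_iff]
    show lens (p, 1) = lens (p', 0) ↔ _
    rw [lens_eq_iff]
    simp
  have hker : ∀ x y, std x = std y ↔ G x = G y := by
    intro x y
    rw [hGi]
    rcases x with p | p <;> rcases y with p' | p'
    · refine ⟨fun h => ?_, fun h => by rw [hl p p' h]⟩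
      rw [(lens_eq_iff.1 (congrArg Subtype.val h)).1]
    · exact (hstdlr p p').trans (hlr p p').symm
    · exact eq_comm.trans ((hstdlr p' p).trans ((hlr p' p).symm.trans eq_comm))
    · refine ⟨fun h => ?_, fun h => by rw [hr p p' h]⟩
      rw [(lens_eq_iff.1 (congrArg Subtype.val h)).1]
  have hquot : IsQuotientMap std := hstd.isClosedMap.isQuotientMap hstd hstds
  let φ : C(S, S) := IsQuotientMap.lift (f := ⟨std, hstd⟩) hquot ⟨G, hG⟩ fun x y h => (hker x y).1 h
  have hφ : ∀ x, φ (std x) = G x := fun x => by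
    have := IsQuotientMap.lift_comp (f := ⟨std, hstd⟩) hquot ⟨G, hG⟩ fun x y h => (hker x y).1 h
    exact DFunLike.congr_fun this x
  have hφi : Function.Injective φ := by
    intro a b h
    obtain ⟨x, rfl⟩ := hstds a
    obtain ⟨y, rfl⟩ := hstds b
    rw [hφ, hφ] at h
    exact (hker x y).2 h
  have hφs : Function.Surjective φ := fun b => by
    obtain ⟨x, rfl⟩ := hGs b
    exact ⟨std x, hφ x⟩
  let q : I × I → Disk := fun x => ⟨radial φ (lens x), by
    rw [mem_closedBall_zero_iff, norm_radial]; exact norm_lens_le x⟩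
  refine ⟨q, ?_, ?_, ?_, fun p => ⟨?_, ?_⟩⟩
  · exact ((continuous_radial φ.continuous).comp continuous_lens).subtype_mk _
  · rintro ⟨z, hz⟩
    obtain ⟨w, rfl⟩ := surjective_radial hφs z
    rw [mem_closedBall_zero_iff, norm_radial] at hz
    obtain ⟨x, rfl⟩ := exists_lens hz
    exact ⟨x, rfl⟩
  · intro p p' t t'
    have h : q (p, t) = q (p', t') ↔ lens (p, t) = lens (p', t') :=
      Subtype.ext_iff.trans (injective_radial hφi).eq_iff
    exact h.trans (lens_eq_iff.trans
      (and_congr_right fun _ => or_congr_right (not_congr mem_interior_interval.symm)))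
  · have h := congrArg Subtype.val (hφ (Sum.inr p))
    rw [← radial_coe] at h
    exact Subtype.ext h
  · have h := congrArg Subtype.val (hφ (Sum.inl p))
    rw [← radial_coe] at h
    exact Subtype.ext h

/-! ### Antilinear involutions of Krein superspaces -/

lemma sgn_zero : sgn 0 = 1 := if_pos rfl

lemma sgn_one : sgn 1 = -1 := if_neg one_ne_zero

lemma zmod_two_cases (i : ZMod 2) : i = 0 ∨ i = 1 := by
  fin_cases i
  · exact Or.inl rfl
  · exact Or.inr rfl

lemma sgn_mul_sgn (i j : ZMod 2) : sgn i * sgn j = sgn (i + j) := by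
  rcases zmod_two_cases i with rfl | rfl <;> rcases zmod_two_cases j with rfl | rfl <;>
    simp [sgn_zero, sgn_one, CharTwo.add_self_eq_zero]

lemma sgn_mul_self (i : ZMod 2) : sgn (i * i) = sgn i := by
  rcases zmod_two_cases i with rfl | rfl <;> simp

lemma conj_sgn (i : ZMod 2) : conj (sgn i) = sgn i := by
  unfold sgn; split_ifs <;> simp

lemma zmod_two_add_add (a b : ZMod 2) : a + b + b = a := by
  rw [add_assoc, CharTwo.add_self_eq_zero, add_zero]

namespace KreinSuperspace

variable {H : KreinSuperspace.{u}}

lemma form_conj (v w : H) : conj (form v w) = form w v := by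
  rw [form, inner_conj_symm, H.J_symm]; rfl

lemma form_add_left (u v w : H) : form (u + v) w = form u w + form v w := inner_add_left _ _ _

lemma form_add_right (u v w : H) : form u (v + w) = form u v + form u w := by
  rw [form, map_add, inner_add_right]; rfl

lemma form_smul_left (c : ℂ) (v w : H) : form (c • v) w = conj c * form v w := inner_smul_left _ _ _

lemma form_smul_right (c : ℂ) (v w : H) : form v (c • w) = c * form v w := by
  rw [form, map_smul, inner_smul_right]; rfl

lemma mem_deg {i : ZMod 2} {v : H} : v ∈ H.deg i ↔ H.parity v = sgn i • v := Iff.rfl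

lemma form_parity (v w : H) : form (H.parity v) w = form v (H.parity w) := by
  rw [form, H.parity_symm, ← H.J_parity]; rfl

lemma exists_add_deg (v : H) : ∃ a ∈ H.deg 0, ∃ b ∈ H.deg 1, a + b = v := by
  refine ⟨(2⁻¹ : ℂ) • (v + H.parity v), ?_, (2⁻¹ : ℂ) • (v - H.parity v), ?_, ?_⟩
  · rw [mem_deg]
    simp [sgn, H.parity_parity, add_comm]
  · rw [mem_deg]
    simp [sgn, H.parity_parity, ← smul_neg]
  · module

lemma form_eq_zero_of_deg {i j : ZMod 2} (hij : i ≠ j) {v w : H} (hv : v ∈ H.deg i)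
    (hw : w ∈ H.deg j) : form v w = 0 := by
  have h := form_parity v w
  rw [mem_deg.1 hv, mem_deg.1 hw, form_smul_left, form_smul_right, conj_sgn] at h
  have h2 : sgn i - sgn j ≠ 0 := by
    rcases zmod_two_cases i with rfl | rfl <;> rcases zmod_two_cases j with rfl | rfl <;>
      first | exact absurd rfl hij | (norm_num [sgn_zero, sgn_one])
  exact (mul_eq_zero.1 (by linear_combination h : (sgn i - sgn j) * form v w = 0)).resolve_left h2

lemma Decomposition.P_le (D : H.Decomposition) (i s : ZMod 2) : D.P i s ≤ H.deg i := by
  rw [← D.sup_eq i]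
  rcases zmod_two_cases s with rfl | rfl
  · exact le_sup_left
  · exact le_sup_right

/-- A compatible real structure on a Krein superspace: an even antilinear involution `α` for which
`⟨α v, α w⟩ = (-1)^{|v||w|} ⟨w, v⟩`. -/
structure IsRealStructure (α : H ≃L⋆[ℂ] H) : Prop where
  involutive : ∀ v, α (α v) = v
  map_deg : ∀ i, ∀ v ∈ H.deg i, α v ∈ H.deg i
  form_deg : ∀ i j, ∀ v ∈ H.deg i, ∀ w ∈ H.deg j, form (α v) (α w) = sgn (i * j) * form w v

namespace IsRealStructure

variable {α : H ≃L⋆[ℂ] H}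

lemma map_mem_deg_iff (hα : IsRealStructure α) {i : ZMod 2} {v : H} :
    α v ∈ H.deg i ↔ v ∈ H.deg i :=
  ⟨fun h => hα.involutive v ▸ hα.map_deg i _ h, hα.map_deg i v⟩

lemma mem_map_iff (hα : IsRealStructure α) (V : Submodule ℂ H) (v : H) :
    v ∈ V.map (α : H →ₛₗ[starRingEnd ℂ] H) ↔ α v ∈ V := by
  constructor
  · rintro ⟨w, hw, rfl⟩
    exact (hα.involutive w).symm ▸ hw
  · exact fun h => ⟨α v, h, hα.involutive v⟩

/-- The image of a decomposition under a compatible real structure. Signs are preserved in degree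
zero and flipped in degree one. -/
noncomputable def mapDecomposition (hα : IsRealStructure α) (D : H.Decomposition) :
    H.Decomposition where
  P i s := (D.P i (s + i)).map (α : H →ₛₗ[starRingEnd ℂ] H)
  isClosed i s := α.toHomeomorph.isClosedMap _ (D.isClosed i (s + i))
  sup_eq i := by
    have h : D.P i (0 + i) ⊔ D.P i (1 + i) = H.deg i := by
      rw [← D.sup_eq i]
      rcases zmod_two_cases i with rfl | rfl
      · rfl
      · exact sup_comm _ _
    rw [← Submodule.map_sup, h]
    ext v
    rw [hα.mem_map_iff, hα.map_mem_deg_iff]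
  orthogonal i := by
    rintro _ ⟨v, hv, rfl⟩ _ ⟨w, hw, rfl⟩
    have h := hα.form_deg i i v (D.P_le _ _ hv) w (D.P_le _ _ hw)
    have h0 : form w v = 0 := by
      rcases zmod_two_cases i with rfl | rfl
      · rw [← form_conj, D.orthogonal 0 v hv w hw, map_zero]
      · exact D.orthogonal 1 w hw v hv
    rw [h0, mul_zero] at h
    exact h
  definite i s := by
    obtain ⟨c, hc, h⟩ := D.definite i (s + i)
    obtain ⟨C, hC, hαC⟩ := (α : H →SL[starRingEnd ℂ] H).bound
    refine ⟨c / C ^ 2, by positivity, ?_⟩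
    rintro _ ⟨v, hv, rfl⟩
    have h1 : sgn s * form (α v) (α v) = sgn (s + i) * form v v := by
      rw [hα.form_deg i i v (D.P_le _ _ hv) v (D.P_le _ _ hv), sgn_mul_self, ← sgn_mul_sgn]; ring
    have h2 : ‖α v‖ ^ 2 ≤ C ^ 2 * ‖v‖ ^ 2 := by
      rw [← mul_pow]; exact pow_le_pow_left₀ (norm_nonneg _) (hαC v) 2
    show c / C ^ 2 * ‖α v‖ ^ 2 ≤ (sgn s * form (α v) (α v)).re
    rw [h1]
    refine le_trans ?_ (h v hv)
    rw [div_mul_eq_mul_div, div_le_iff₀ (by positivity)]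
    nlinarith

/-- The image of an adapted orthonormal basis is an orthonormal basis adapted to the image of the
decomposition. -/
lemma map_isOrthonormalBasis (hα : IsRealStructure α) {D : H.Decomposition} {K : Type*} {ζ : K → H}
    {d s : K → ZMod 2} (h : IsOrthonormalBasis D ζ d s) :
    IsOrthonormalBasis (hα.mapDecomposition D) (fun k => α (ζ k)) d (fun k => s k + d k) where
  mem k := by
    refine ⟨ζ k, ?_, rfl⟩
    show ζ k ∈ D.P (d k) (s k + d k + d k)
    rw [zmod_two_add_add]
    exact h.mem k
  form_self k := by
    have hk := D.P_le _ _ (h.mem k)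
    rw [hα.form_deg _ _ _ hk _ hk, h.form_self, sgn_mul_self, sgn_mul_sgn, add_comm]
  form_ne k l hkl := by
    rw [hα.form_deg _ _ _ (D.P_le _ _ (h.mem k)) _ (D.P_le _ _ (h.mem l)),
      h.form_ne l k hkl.symm, mul_zero]
  total i t := by
    have hset : {v | ∃ k, d k = i ∧ s k + d k = t ∧ α (ζ k) = v} =
        (α : H →ₛₗ[starRingEnd ℂ] H) '' {v | ∃ k, d k = i ∧ s k = t + i ∧ ζ k = v} := by
      ext v
      constructor
      · rintro ⟨k, rfl, rfl, rfl⟩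
        exact ⟨ζ k, ⟨k, rfl, (zmod_two_add_add _ _).symm, rfl⟩, rfl⟩
      · rintro ⟨_, ⟨k, rfl, hk, rfl⟩, rfl⟩
        exact ⟨k, rfl, by rw [hk, zmod_two_add_add], rfl⟩
    apply SetLike.coe_injective
    rw [hset, Submodule.span_image, Submodule.topologicalClosure_coe, Submodule.map_coe]
    have h1 := α.toHomeomorph.image_closure
      (Submodule.span ℂ {v | ∃ k, d k = i ∧ s k = t + i ∧ ζ k = v} : Set H)
    refine h1.symm.trans ?_
    rw [← Submodule.topologicalClosure_coe, h.total]
    rfl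

end IsRealStructure

/-! ### The modulus of an antilinear involution of a Hilbert space -/

section Modulus

variable {F : Type*} [NormedAddCommGroup F] [InnerProductSpace ℂ F]

lemma isPositive_conj {U T : F →L[ℂ] F} (hU : ∀ v w, inner ℂ (U v) w = inner ℂ v (U w))
    (hT : T.IsPositive) : (U.comp (T.comp U)).IsPositive := by
  refine ⟨fun v w => ?_, fun v => ?_⟩
  · show inner ℂ (U (T (U v))) w = inner ℂ v (U (T (U w)))
    rw [hU, hT.inner_left_eq_inner_right, hU]
  · show 0 ≤ RCLike.re (inner ℂ (U (T (U v))) v)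
    rw [hU]
    exact hT.re_inner_nonneg_left _

variable [CompleteSpace F]

/-- A positive operator is determined by its square. -/
lemma eq_of_isPositive_of_sq {S T : F →L[ℂ] F} (hS : S.IsPositive) (hT : T.IsPositive)
    (h : ∀ v, S (S v) = T (T v)) : S = T := by
  rw [← ContinuousLinearMap.nonneg_iff_isPositive] at hS hT
  exact (CFC.mul_self_eq_mul_self_iff S T hS hT).1 (ContinuousLinearMap.ext h)

/-- Let `a` be an antilinear involution with adjoint `a'`. The modulus `R` of `a`, that is, the
positive square root of `a' a`, has the inverse `T = a R a`: both `T` and `a T a'` are positive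
square roots of `a a'`, the inverse of `a' a`. -/
lemma exists_modulus (a a' : F →L⋆[ℂ] F) (ha : ∀ v, a (a v) = v)
    (hadj : ∀ v w, inner ℂ (a v) w = inner ℂ (a' w) v) :
    ∃ R T : F →L[ℂ] F, R.IsPositive ∧ T.IsPositive ∧ (∀ v, R (R v) = a' (a v)) ∧
      (∀ v, T (T v) = a (a' v)) ∧ (∀ v, R (T v) = v) ∧ (∀ v, T (R v) = v) ∧
      ∀ v, R (a v) = a (T v) := by
  have ha' : ∀ v, a' (a' v) = v := by
    intro w
    refine ext_inner_left ℂ fun v => ?_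
    rw [← inner_conj_symm, ← hadj, inner_conj_symm, ← hadj, ha]
  have hB : (a'.comp a : F →L[ℂ] F).IsPositive := by
    refine ⟨fun v w => ?_, fun v => ?_⟩
    · show inner ℂ (a' (a v)) w = inner ℂ v (a' (a w))
      rw [← hadj, ← inner_conj_symm v, ← hadj, inner_conj_symm]
    · show 0 ≤ RCLike.re (inner ℂ (a' (a v)) v)
      rw [← hadj]
      exact inner_self_nonneg
  let B : F →L[ℂ] F := a'.comp a
  let B' : F →L[ℂ] F := a.comp a'
  have hB0 : 0 ≤ B := (ContinuousLinearMap.nonneg_iff_isPositive _).2 hB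
  let R : F →L[ℂ] F := CFC.sqrt B
  have hR : R.IsPositive := (ContinuousLinearMap.nonneg_iff_isPositive _).1 (CFC.sqrt_nonneg B)
  have hRR : ∀ v, R (R v) = a' (a v) := fun v =>
    DFunLike.congr_fun (CFC.sqrt_mul_sqrt_self B hB0) v
  have hBB' : ∀ v, a' (a (B' v)) = v := fun v => by
    show a' (a (a (a' v))) = v
    rw [ha, ha']
  have hB'B : ∀ v, B' (a' (a v)) = v := fun v => by
    show a (a' (a' (a v))) = v
    rw [ha', ha]
  have hcomm : ∀ v, B' (R v) = R (B' v) := by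
    intro v
    conv_lhs => rw [← hBB' v, ← hRR, hRR (R _), hB'B]
  have hB's : ∀ v w, inner ℂ (B' v) w = inner ℂ v (B' w) := by
    intro v w
    show inner ℂ (a (a' v)) w = inner ℂ v (a (a' w))
    rw [hadj, ← inner_conj_symm v, hadj, inner_conj_symm]
  let T : F →L[ℂ] F := R.comp B'
  have hRT : ∀ v, R (T v) = v := fun v => by
    show R (R (B' v)) = v
    rw [hRR, hBB']
  have hTR : ∀ v, T (R v) = v := fun v => by
    show R (B' (R v)) = v
    rw [hcomm, hRR, hBB']
  have hTs : ∀ v w, inner ℂ (T v) w = inner ℂ v (T w) := by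
    intro v w
    show inner ℂ (R (B' v)) w = inner ℂ v (R (B' w))
    rw [hR.inner_left_eq_inner_right, hB's, hcomm]
  have hTT : ∀ v, T (T v) = a (a' v) := fun v => by
    exact hTR (B' v)
  have hT : T.IsPositive := by
    have h : T.comp (R.comp T) = T := ContinuousLinearMap.ext fun v => congrArg T (hRT v)
    exact h ▸ isPositive_conj hTs hR
  have hX : (a.comp (T.comp a') : F →L[ℂ] F).IsPositive := by
    refine ⟨fun v w => ?_, fun v => ?_⟩
    · show inner ℂ (a (T (a' v))) w = inner ℂ v (a (T (a' w)))
      rw [hadj, ← inner_conj_symm v, hadj, inner_conj_symm, hTs]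
    · show 0 ≤ RCLike.re (inner ℂ (a (T (a' v))) v)
      rw [hadj]
      exact hT.re_inner_nonneg_right _
  have hXT : (a.comp (T.comp a') : F →L[ℂ] F) = T := by
    refine eq_of_isPositive_of_sq hX hT fun v => ?_
    show a (T (a' (a (T (a' v))))) = T (T v)
    rw [← hRR, hRT, hTR, hTT]
  -- apply `a T a' = T` to vectors of the form `a u`
  have h1 : ∀ u, T (a u) = a (R u) := by
    intro u
    rw [← hXT]
    show a (T (a' (a u))) = a (R u)
    rw [← hRR, hTR]
  refine ⟨R, T, hR, hT, hRR, hTT, hRT, hTR, fun v => ?_⟩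
  rw [← hRT (a (T v)), h1, hRT]

end Modulus

/-! ### Fundamental symmetries and invariant decompositions -/

/-- The decomposition into the eigenspaces of a fundamental symmetry `K` that preserves degrees. -/
noncomputable def decompositionOfSymmetry (K : H →L[ℂ] H) (hK : ∀ v, K (K v) = v)
    (hKs : ∀ v w, form (K v) w = form v (K w)) (hKp : ∀ v, K (H.parity v) = H.parity (K v))
    (hpos : ∃ c : ℝ, 0 < c ∧ ∀ v, c * ‖v‖ ^ 2 ≤ (form v (K v)).re) : H.Decomposition where
  P i s := H.deg i ⊓ LinearMap.ker (K - sgn s • ContinuousLinearMap.id ℂ H).toLinearMap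
  isClosed i s := by
    have h1 : IsClosed {v : H | H.parity v = sgn i • v} :=
      isClosed_eq (by fun_prop) (by fun_prop)
    exact h1.inter (K - sgn s • ContinuousLinearMap.id ℂ H).isClosed_ker
  sup_eq i := by
    refine le_antisymm (sup_le inf_le_left inf_le_left) fun v hv => ?_
    have hKv : K v ∈ H.deg i := by
      rw [mem_deg, ← hKp, mem_deg.1 hv, map_smul]
    have h : v = (2⁻¹ : ℂ) • (v + K v) + (2⁻¹ : ℂ) • (v - K v) := by module
    rw [h]
    refine Submodule.add_mem_sup ⟨?_, ?_⟩ ⟨?_, ?_⟩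
    · exact Submodule.smul_mem _ _ (Submodule.add_mem _ hv hKv)
    · simp [sgn_zero, hK, add_comm]
    · exact Submodule.smul_mem _ _ (Submodule.sub_mem _ hv hKv)
    · simp [sgn_one, hK]
  orthogonal i := by
    rintro v ⟨-, hv⟩ w ⟨-, hw⟩
    have hv' : K v = v := by simpa [sgn_zero, sub_eq_zero] using hv
    have hw' : K w = (-1 : ℂ) • w := by simpa [sgn_one, add_eq_zero_iff_eq_neg] using hw
    have h := hKs v w
    rw [hv', hw', form_smul_right] at h
    linear_combination h / 2
  definite i s := by
    obtain ⟨c, hc, h⟩ := hpos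
    refine ⟨c, hc, ?_⟩
    rintro v ⟨-, hv⟩
    have hv' : K v = sgn s • v := by simpa [sub_eq_zero] using hv
    have := h v
    rwa [hv', form_smul_right] at this

lemma mem_decompositionOfSymmetry {K : H →L[ℂ] H} {hK hKs hKp hpos} {i s : ZMod 2} {v : H} :
    v ∈ (decompositionOfSymmetry K hK hKs hKp hpos).P i s ↔ v ∈ H.deg i ∧ K v = sgn s • v := by
  refine and_congr_right fun _ => ?_
  simp [sub_eq_zero]

namespace IsRealStructure

variable {α : H ≃L⋆[ℂ] H}

lemma parity_apply (hα : IsRealStructure α) (v : H) : H.parity (α v) = α (H.parity v) := by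
  obtain ⟨a, ha, b, hb, rfl⟩ := exists_add_deg v
  simp only [map_add, mem_deg.1 ha, mem_deg.1 hb, mem_deg.1 (hα.map_deg 0 a ha),
    mem_deg.1 (hα.map_deg 1 b hb), map_smulₛₗ, conj_sgn]

lemma form_apply (hα : IsRealStructure α) (v w : H) :
    form (α v) (α w) = form w (H.parity v) := by
  have h : ∀ i j, ∀ v ∈ H.deg i, ∀ w ∈ H.deg j, form (α v) (α w) = form w (H.parity v) := by
    intro i j v hv w hw
    rw [hα.form_deg i j v hv w hw, mem_deg.1 hv, form_smul_right]
    rcases eq_or_ne i j with rfl | hij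
    · rw [sgn_mul_self]
    · rw [form_eq_zero_of_deg hij.symm hw hv, mul_zero, mul_zero]
  obtain ⟨a, ha, b, hb, rfl⟩ := exists_add_deg v
  obtain ⟨c, hc, d, hd, rfl⟩ := exists_add_deg w
  simp only [map_add, form_add_left, form_add_right, h _ _ a ha c hc, h _ _ a ha d hd,
    h _ _ b hb c hc, h _ _ b hb d hd]
  ring

/-- There is a decomposition whose pieces are permuted by the real structure. With the modulus `R`
of `α`, the operator `J R` is a fundamental symmetry that commutes with `α` in degree zero and
anticommutes with `α` in degree one; the decomposition is that into its eigenspaces. -/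
lemma exists_decomposition (hα : IsRealStructure α) :
    ∃ D : H.Decomposition, ∀ i s, α '' (D.P i s) = D.P i (s + i) := by
  let a : H →L⋆[ℂ] H := α
  let a' : H →L⋆[ℂ] H := (H.J.comp H.parity).comp (a.comp H.J)
  have hadj : ∀ v w, inner ℂ (a v) w = inner ℂ (a' w) v := by
    intro v w
    have h := hα.form_apply v (α (H.J w))
    rw [hα.involutive, form, H.J_J, ← form_parity, form, ← H.J_symm] at h
    exact h
  obtain ⟨R, T, hR, hT, hRR, hTT, hRT, hTR, hRa⟩ := exists_modulus a a' hα.involutive hadj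
  have hJRJ : H.J.comp (R.comp H.J) = T := by
    refine eq_of_isPositive_of_sq (isPositive_conj H.J_symm hR) hT fun v => ?_
    show H.J (R (H.J (H.J (R (H.J v))))) = T (T v)
    rw [H.J_J, hRR, hTT]
    show H.J (H.J (H.parity (α (H.J (α (H.J v)))))) = α (H.J (H.parity (α (H.J v))))
    rw [H.J_J, hα.parity_apply, H.J_parity]
  have hPRP : H.parity.comp (R.comp H.parity) = R := by
    refine eq_of_isPositive_of_sq (isPositive_conj H.parity_symm hR) hR fun v => ?_
    show H.parity (R (H.parity (H.parity (R (H.parity v))))) = R (R v)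
    rw [H.parity_parity, hRR, hRR]
    show H.parity (H.J (H.parity (α (H.J (α (H.parity v)))))) =
      H.J (H.parity (α (H.J (α v))))
    simp only [H.J_parity, ← hα.parity_apply, H.parity_parity]
  have hJR : ∀ v, H.J (R v) = T (H.J v) := fun v => by
    rw [← hJRJ]
    show H.J (R v) = H.J (R (H.J (H.J v)))
    rw [H.J_J]
  have hPR : ∀ v, R (H.parity v) = H.parity (R v) := fun v => by
    conv_rhs => rw [← hPRP]
    show R (H.parity v) = H.parity (H.parity (R (H.parity v)))
    rw [H.parity_parity]
  -- the fundamental symmetry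
  let K : H →L[ℂ] H := H.J.comp R
  have hK : ∀ v, K (K v) = v := fun v => by
    show H.J (R (H.J (R v))) = v
    rw [hJR, H.J_J, hTR]
  have hKs : ∀ v w, form (K v) w = form v (K w) := fun v w => by
    show inner ℂ (H.J (R v)) (H.J w) = inner ℂ v (H.J (H.J (R w)))
    rw [H.J_symm, H.J_J, H.J_J, hR.inner_left_eq_inner_right]
  have hKp : ∀ v, K (H.parity v) = H.parity (K v) := fun v => by
    show H.J (R (H.parity v)) = H.parity (H.J (R v))
    rw [hPR, H.J_parity]
  have hpos : ∃ c : ℝ, 0 < c ∧ ∀ v, c * ‖v‖ ^ 2 ≤ (form v (K v)).re := by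
    -- a square root `q` of `R` has the left inverse `T q`, hence is bounded below
    let q : H →L[ℂ] H := CFC.sqrt R
    have hR0 : 0 ≤ R := (ContinuousLinearMap.nonneg_iff_isPositive _).2 hR
    have hq : q.IsPositive := (ContinuousLinearMap.nonneg_iff_isPositive _).1 (CFC.sqrt_nonneg R)
    have hqq : ∀ v, q (q v) = R v := fun v => DFunLike.congr_fun (CFC.sqrt_mul_sqrt_self R hR0) v
    obtain ⟨C, hC, hTq⟩ := (T.comp q).bound
    refine ⟨1 / C ^ 2, by positivity, fun v => ?_⟩
    have h1 : form v (K v) = inner ℂ (q v) (q v) := by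
      show inner ℂ v (H.J (H.J (R v))) = _
      rw [H.J_J, hq.inner_left_eq_inner_right, hqq]
    have h2 : ‖v‖ ≤ C * ‖q v‖ := by
      have := hTq (q v)
      rwa [ContinuousLinearMap.comp_apply, hqq, hTR] at this
    have h3 : ‖v‖ ^ 2 ≤ C ^ 2 * ‖q v‖ ^ 2 := by
      rw [← mul_pow]; exact pow_le_pow_left₀ (norm_nonneg _) h2 2
    have h4 : (inner ℂ (q v) (q v)).re = ‖q v‖ ^ 2 := inner_self_eq_norm_sq (𝕜 := ℂ) (q v)
    rw [h1, h4, one_div_mul_eq_div, div_le_iff₀ (by positivity)]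
    linarith
  have hKα : ∀ v, K (α v) = H.parity (α (K v)) := fun v => by
    -- the definition of the adjoint, solved for `J α J`
    have h : ∀ x, H.J (α (H.J x)) = H.parity (α (T (T x))) := by
      intro x
      have h1 : R (R (α x)) = H.J (H.parity (α (H.J (α (α x))))) := hRR (α x)
      have h2 : R (R (α x)) = α (T (T x)) := by
        rw [show R (α x) = α (T x) from hRa x]
        exact hRa (T x)
      rw [← h2, h1, hα.involutive, H.J_parity, H.parity_parity]
    have hJT : T v = H.J (R (H.J v)) := by rw [hJR, H.J_J]
    show H.J (R (α v)) = H.parity (α (H.J (R v)))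
    rw [show R (α v) = α (T v) from hRa v, hJT, h, hTR, hJR]
  refine ⟨decompositionOfSymmetry K hK hKs hKp hpos, fun i s => ?_⟩
  have hmap : ∀ i s, ∀ v ∈ (decompositionOfSymmetry K hK hKs hKp hpos).P i s,
      α v ∈ (decompositionOfSymmetry K hK hKs hKp hpos).P i (s + i) := by
    intro i s v hv
    rw [mem_decompositionOfSymmetry] at hv ⊢
    refine ⟨hα.map_deg i v hv.1, ?_⟩
    rw [hKα, hv.2, map_smulₛₗ, map_smul, mem_deg.1 (hα.map_deg i v hv.1), conj_sgn, smul_smul,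
      sgn_mul_sgn]
  refine Set.Subset.antisymm ?_ fun v hv => ⟨α v, ?_, hα.involutive v⟩
  · rintro _ ⟨v, hv, rfl⟩
    exact hmap i s v hv
  · have := hmap i (s + i) v hv
    rwa [zmod_two_add_add] at this

end IsRealStructure

end KreinSuperspace

/-! ### Elementary gluing functions of the interval -/

namespace ElementaryMaps

open Hypersurface

lemma inl_mem_interior {M : Hypersurface} {p : I} (hp : p ∈ Set.Ioo (0 : I) 1) :
    (Sum.inl p : (interval.sum M).carrier) ∈ (interval.sum M).interior :=
  inl_mem_interior_sum.2 (mem_interior_interval.2 hp)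

lemma inr_mem_interior {M : Hypersurface} {p : I} (hp : p ∈ Set.Ioo (0 : I) 1) :
    (Sum.inr p : (M.sum interval).carrier) ∈ (M.sum interval).interior :=
  inr_mem_interior_sum.2 (mem_interior_interval.2 hp)

/-- A twist of the interval, as a map of numbers. -/
def twistMap (f : HGluing interval interval.rev) (p : I) : I := f.toFun p

/-- The first arc of a gluing of two intervals to one, as a map of numbers. -/
def arcL (k : HGluing (interval.sum interval) interval) (p : I) : I := k.toFun (Sum.inl p)

/-- The second arc of a gluing of two intervals to one, as a map of numbers. -/
def arcR (k : HGluing (interval.sum interval) interval) (p : I) : I := k.toFun (Sum.inr p)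

/-- The twist of the interval exchanges its end points, being order reversing. -/
lemma twistMap_zero_one (f : HGluing interval interval.rev) (hf : Function.Injective f) :
    twistMap f 0 = 1 ∧ twistMap f 1 = 0 := by
  let g : I → I := fun t => unitInterval.symm (twistMap f t)
  have hg : Continuous g := unitInterval.continuous_symm.comp f.continuous_toFun
  have hi : Function.Injective g := unitInterval.symm_bijective.injective.comp hf
  obtain ⟨p, hp⟩ : ∃ p : I, p ∈ Set.Ioo (0 : I) 1 := exists_between zero_lt_one
  have ho : SameOrderAt (fun y : I => y) g p :=
    f.orientation p (mem_interior_interval.2 hp) _ rfl (Set.mem_univ _) _ ⟨_, rfl, rfl⟩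
      (Set.mem_univ _)
  have hanti : StrictAnti (twistMap f) := fun s t hst =>
    unitInterval.symm_lt_symm.1 (strictMono_of_sameOrderAt hg hi.injOn hp ho hst)
  obtain ⟨a, ha⟩ : ∃ a, twistMap f a = 1 := f.surjective_toFun (1 : I)
  obtain ⟨b, hb⟩ : ∃ b, twistMap f b = 0 := f.surjective_toFun (0 : I)
  constructor
  · exact le_antisymm unitInterval.le_one' (ha ▸ hanti.antitone unitInterval.nonneg')
  · exact le_antisymm (hb ▸ hanti.antitone unitInterval.le_one') unitInterval.nonneg'

/-- A gluing of two intervals to one arranges them one after the other, in one of two orders. -/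
lemma gluing_structure (k : HGluing (interval.sum interval) interval) :
    StrictMono (arcL k) ∧ StrictMono (arcR k) ∧
      ((arcL k 1 = arcR k 0 ∧ arcL k 0 = 0 ∧ arcR k 1 = 1) ∨
        (arcR k 1 = arcL k 0 ∧ arcR k 0 = 0 ∧ arcL k 1 = 1)) := by
  have hl : Continuous (arcL k) := k.continuous_toFun.comp continuous_inl
  have hr : Continuous (arcR k) := k.continuous_toFun.comp continuous_inr
  have hinj : Set.InjOn k.toFun (interval.sum interval).interior :=
    Set.injOn_iff_injective.2 k.isEmbedding_interior.injective
  have hli : Set.InjOn (arcL k) (Set.Ioo 0 1) := fun p hp q hq h =>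
    Sum.inl_injective (hinj (inl_mem_interior hp) (inl_mem_interior hq) h)
  have hri : Set.InjOn (arcR k) (Set.Ioo 0 1) := fun p hp q hq h =>
    Sum.inr_injective (hinj (inr_mem_interior hp) (inr_mem_interior hq) h)
  obtain ⟨p, hp⟩ : ∃ p : I, p ∈ Set.Ioo (0 : I) 1 := exists_between zero_lt_one
  have hol : SameOrderAt (fun y : I => y) (arcL k) p :=
    SameOrderAt.comp (j := (Sum.inl : I → I ⊕ I)) continuous_inl.continuousAt
      (k.orientation _ (inl_mem_interior hp) _ (Or.inl ⟨_, rfl, rfl⟩) ⟨p, Set.mem_univ _, rfl⟩ _ rfl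
        (Set.mem_univ _))
  have hor : SameOrderAt (fun y : I => y) (arcR k) p :=
    SameOrderAt.comp (j := (Sum.inr : I → I ⊕ I)) continuous_inr.continuousAt
      (k.orientation _ (inr_mem_interior hp) _ (Or.inr ⟨_, rfl, rfl⟩) ⟨p, Set.mem_univ _, rfl⟩ _ rfl
        (Set.mem_univ _))
  have hlm := strictMono_of_sameOrderAt hl hli hp hol
  have hrm := strictMono_of_sameOrderAt hr hri hp hor
  refine ⟨hlm, hrm, endpoints_of_cover hl hr hlm hrm (fun u hu p hp h => ?_) fun z => ?_⟩
  · exact Sum.inl_ne_inr (hinj (inl_mem_interior hu) (inr_mem_interior hp) h)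
  · obtain ⟨x | x, hx⟩ := k.surjective_toFun z
    · exact Or.inl ⟨x, hx⟩
    · exact Or.inr ⟨x, hx⟩

/-- An arc of a closed path `C` without further self-intersections is embedded unless it is the whole
path. -/
lemma arc_injective {X : Type*} {C : I → X}
    (hC : ∀ s t, C s = C t ↔ s = t ∨ (s = 0 ∧ t = 1) ∨ (t = 0 ∧ s = 1))
    {r : I → I} (hr : StrictMono r) (h : r 0 ≠ 0 ∨ r 1 ≠ 1) :
    Function.Injective fun p => C (r p) := by
  have key : ∀ p q, ¬ (r p = 0 ∧ r q = 1) := by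
    rintro p q ⟨h0, h1⟩
    rcases h with h | h
    · exact h (le_antisymm ((hr.monotone unitInterval.nonneg').trans h0.le) unitInterval.nonneg')
    · exact h (le_antisymm unitInterval.le_one' (h1.ge.trans (hr.monotone unitInterval.le_one')))
  intro p q hpq
  rcases (hC _ _).1 hpq with h1 | h1 | h1
  · exact hr.injective h1
  · exact absurd h1 (key p q)
  · exact absurd h1 (key q p)

/-- Two consecutive arcs that make up a closed path without further self-intersections meet exactly
at their end points. -/
lemma arcs_eq_iff {X : Type*} {C : I → X}
    (hC : ∀ s t, C s = C t ↔ s = t ∨ (s = 0 ∧ t = 1) ∨ (t = 0 ∧ s = 1))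
    {l r : I → I} (hl : StrictMono l) (hr : StrictMono r)
    (h : l 1 = r 0 ∧ l 0 = 0 ∧ r 1 = 1) (u p : I) :
    C (l u) = C (r p) ↔ (u = 1 ∧ p = 0) ∨ (u = 0 ∧ p = 1) := by
  obtain ⟨h1, h2, h3⟩ := h
  have hl1 : l u ≤ l 1 := hl.monotone unitInterval.le_one'
  have hr0 : r 0 ≤ r p := hr.monotone unitInterval.nonneg'
  rw [hC]
  constructor
  · rintro (h | ⟨h, h'⟩ | ⟨h, h'⟩)
    · exact Or.inl ⟨hl.injective (le_antisymm hl1 (h1.trans_le (hr0.trans h.ge))),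
        hr.injective (le_antisymm (h.ge.trans (hl1.trans h1.le)) hr0)⟩
    · exact Or.inr ⟨hl.injective (h.trans h2.symm), hr.injective (h'.trans h3.symm)⟩
    · have h4 : r 0 < r 1 := hr zero_lt_one
      rw [h'] at hl1
      exact absurd ((hl1.trans h1.le).trans_lt h4) (not_lt.2 unitInterval.le_one')
  · rintro (⟨rfl, rfl⟩ | ⟨rfl, rfl⟩)
    · exact Or.inl h1
    · exact Or.inr (Or.inl ⟨h2, h3⟩)

/-- A gluing of the interval to the circle identifies exactly the end points. -/
lemma fIC_eq_iff (f : HGluing interval circle) {s t : I} (hst : s < t) :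
    f s = f t ↔ s = 0 ∧ t = 1 := by
  have hF : Continuous fun t : I => circleHomeo (f t) :=
    circleHomeo.continuous.comp f.continuous_toFun
  rw [← path_eq_iff hF (circleHomeo.surjective.comp f.surjective_toFun) ?_ hst]
  · exact circleHomeo.injective.eq_iff.symm
  · intro p hp q hq h
    exact congrArg Subtype.val (f.isEmbedding_interior.injective (circleHomeo.injective h) :
      (⟨p, mem_interior_interval.2 hp⟩ : interval.interior) = ⟨q, mem_interior_interval.2 hq⟩)

/-- Two intervals, the first one twisted, glued to one another by `k` and then to a circle. -/
noncomputable def face (E : ElementaryMaps) (k : HGluing (interval.sum interval) interval) :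
    HGluing (interval.rev.sum interval) circle :=
  (E.fIC.comp k).comp (E.twistI.untwist.sum (HGluing.id interval))

/-- The two intervals glued to the circle are the faces of the disk as a slice region. The order in
which they are glued to each other is immaterial. -/
lemma isSliceRegion_face (E : ElementaryMaps) (k : HGluing (interval.sum interval) interval) :
    IsSliceRegion interval Region.disk (E.face k) := by
  let C : I → circle.carrier := fun t => E.fIC.toFun t
  have hC : ∀ s t, C s = C t ↔ s = t ∨ (s = 0 ∧ t = 1) ∨ (t = 0 ∧ s = 1) := by
    intro s t
    rcases lt_trichotomy s t with h | rfl | h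
    · refine (fIC_eq_iff E.fIC h).trans ⟨fun h' => Or.inr (Or.inl h'), ?_⟩
      rintro (rfl | h' | ⟨rfl, rfl⟩)
      · exact absurd h (lt_irrefl _)
      · exact h'
      · exact absurd h (not_lt.2 zero_le_one)
    · simp
    · refine (eq_comm.trans (fIC_eq_iff E.fIC h)).trans ⟨fun h' => Or.inr (Or.inr h'), ?_⟩
      rintro (rfl | ⟨rfl, rfl⟩ | h')
      · exact absurd h (lt_irrefl _)
      · exact absurd h (not_lt.2 zero_le_one)
      · exact h'
  have htw : Function.Injective (twistMap E.twistI) := fun s t h => by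
    have h1 : E.twistI (E.twistI s) = E.twistI (E.twistI t) := congrArg (fun x => E.twistI x) h
    exact (E.twistI_twistI s).symm.trans (h1.trans (E.twistI_twistI t))
  obtain ⟨tw0, tw1⟩ := twistMap_zero_one E.twistI htw
  obtain ⟨hl, hr, hk⟩ := gluing_structure k
  have hl01 := hl zero_lt_one
  have hr01 := hr zero_lt_one
  have hlr : ∀ u p, C (arcL k u) = C (arcR k p) ↔ (u = 1 ∧ p = 0) ∨ (u = 0 ∧ p = 1) := by
    intro u p
    rcases hk with h | h
    · exact arcs_eq_iff hC hl hr h u p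
    · rw [eq_comm, arcs_eq_iff hC hr hl h p u, or_comm, and_comm, and_comm (a := p = 1)]
  have hre : arcR k 0 ≠ 0 ∨ arcR k 1 ≠ 1 := by
    rcases hk with ⟨h1, h2, -⟩ | ⟨h1, -, h3⟩
    · exact Or.inl (by rw [← h1, ← h2]; exact hl01.ne')
    · exact Or.inr (by rw [h1, ← h3]; exact hl01.ne)
  have hle : arcL k 0 ≠ 0 ∨ arcL k 1 ≠ 1 := by
    rcases hk with ⟨h1, -, h3⟩ | ⟨h1, h2, -⟩
    · exact Or.inr (by rw [h1, ← h3]; exact hr01.ne)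
    · exact Or.inl (by rw [← h1, ← h2]; exact hr01.ne')
  refine isSliceRegion_disk _ (fun p p' h => ?_) (fun p p' h => ?_) fun p p' => ?_
  · exact arc_injective hC hr hre h
  · exact htw (arc_injective hC hl hle h)
  · refine (hlr (twistMap E.twistI p) p').trans ?_
    have h0 : twistMap E.twistI p = 1 ↔ p = 0 :=
      ⟨fun h => htw (h.trans tw0.symm), fun h => h ▸ tw0⟩
    have h1 : twistMap E.twistI p = 0 ↔ p = 1 :=
      ⟨fun h => htw (h.trans tw1.symm), fun h => h ▸ tw1⟩
    rw [h0, h1, unitInterval.pos_iff_ne_zero, unitInterval.lt_one_iff_ne_one, not_and_or, not_not,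
      not_not]
    constructor
    · rintro (⟨rfl, rfl⟩ | ⟨rfl, rfl⟩)
      · exact ⟨rfl, Or.inl rfl⟩
      · exact ⟨rfl, Or.inr rfl⟩
    · rintro ⟨rfl, rfl | rfl⟩
      · exact Or.inl ⟨rfl, rfl⟩
      · exact Or.inr ⟨rfl, rfl⟩

end ElementaryMaps

/-! ### The inner product of the state space of the interval -/

namespace Theory

open Hypersurface KreinSuperspace

variable {A : Admissibility} (Z : Theory.{u} A) (E : ElementaryMaps)

/-- Evaluation on the disk of two states of the interval, the first one twisted. -/
lemma form_eq_disk (hD : A.reg Region.disk) (k : HGluing (interval.sum interval) interval)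
    (ψ η : Z.H interval) :
    ∃ h : Z.γ E.fIC (Z.γ k (Z.tens (Z.realStructure E.twistI ψ) η)) ∈ Z.dom circle,
      form ψ η = Z.ρ Region.disk ⟨_, h⟩ := by
  have hs := E.isSliceRegion_face k
  have heq : Z.γ (E.face k) (Z.tens (Z.ι interval ψ) η) =
      Z.γ E.fIC (Z.γ k (Z.tens (Z.realStructure E.twistI ψ) η)) := by
    rw [ElementaryMaps.face, γ_comp, γ_comp, Z.tens_γ, Z.γ_id, realStructure_eq]
  have hmem := Z.slice_mem interval Region.disk (E.face k) hD hs (Z.ι interval ψ) η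
  refine ⟨heq ▸ hmem, ?_⟩
  rw [Z.slice interval Region.disk (E.face k) hD hs ψ η]
  congr 1
  exact Subtype.ext heq

/-- Up to sign, the real structure reverses the inner product: gluing the two intervals in the
opposite order also exhibits the disk as a slice region, and by symmetry this exchanges the two
tensor factors. -/
lemma isRealStructure (hZ : Z.IsSymmetric) (hD : A.reg Region.disk) :
    IsRealStructure (Z.realStructureEquiv E.twistI E.twistI_twistI) where
  involutive v := by
    rw [realStructureEquiv_apply, realStructureEquiv_apply]
    exact Z.realStructure_realStructure _ E.twistI_twistI v
  map_deg i v hv := by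
    rw [realStructureEquiv_apply]
    exact Z.realStructure_mem_deg _ hv
  form_deg i j ψ hψ η hη := by
    rw [realStructureEquiv_apply, realStructureEquiv_apply]
    have hη' := Z.realStructure_mem_deg E.twistI hη
    obtain ⟨h, hform⟩ := Z.form_eq_disk E hD E.fII (Z.realStructure E.twistI ψ)
      (Z.realStructure E.twistI η)
    obtain ⟨h', hform'⟩ := Z.form_eq_disk E hD (E.fII.comp (HGluing.sumSwap interval interval)) η ψ
    have hsq : sgn (i * j) * sgn (i * j) = 1 := by
      rw [sgn_mul_sgn, CharTwo.add_self_eq_zero, sgn_zero]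
    have hswap : (⟨_, h'⟩ : Z.dom circle) = sgn (i * j) • ⟨_, h⟩ := by
      apply Subtype.ext
      show Z.γ E.fIC (Z.γ (E.fII.comp (HGluing.sumSwap interval interval))
        (Z.tens (Z.realStructure E.twistI η) ψ)) = sgn (i * j) • Z.γ E.fIC (Z.γ E.fII
          (Z.tens (Z.realStructure E.twistI (Z.realStructure E.twistI ψ))
            (Z.realStructure E.twistI η)))
      rw [γ_comp, hZ interval interval j i _ hη' ψ hψ, map_smul, map_smul,
        Z.realStructure_realStructure _ E.twistI_twistI, mul_comm j i]
    rw [hform', hswap, map_smul, hform, smul_eq_mul, ← mul_assoc, hsq, one_mul]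

end Theory

end CQFT


theorem mainTheorem6 (A : Admissibility) (Z : Theory.{u} A) (hZ : Z.IsSymmetric)
    (hD : A.reg Region.disk) (E : ElementaryMaps) :
    -- the inner product of the state space of the interval
    (∀ ψ η : Z.H Hypersurface.interval,
      ∃ h : Z.γ E.fIC (Z.γ E.fII (Z.tens (Z.realStructure E.twistI ψ) η)) ∈ Z.dom circle,
        KreinSuperspace.form ψ η = Z.ρ Region.disk ⟨_, h⟩) ∧
    -- compatibility of the inner product with the real structure
    (∀ i j : ZMod 2, ∀ ψ ∈ (Z.H Hypersurface.interval).deg i,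
      ∀ η ∈ (Z.H Hypersurface.interval).deg j,
        KreinSuperspace.form (Z.realStructure E.twistI ψ) (Z.realStructure E.twistI η) =
            sgn (i * j) * KreinSuperspace.form η ψ ∧
          sgn (i * j) * KreinSuperspace.form η ψ =
            sgn (i * j) * conj (KreinSuperspace.form ψ η)) ∧
    -- the real structure maps decompositions to decompositions and orthonormal bases to
    -- orthonormal bases, with preserved signs in degree zero and flipped signs in degree one
    (∀ D : (Z.H Hypersurface.interval).Decomposition,
      ∃ D' : (Z.H Hypersurface.interval).Decomposition,
        (∀ i s : ZMod 2, (D'.P i (s + i) : Set (Z.H Hypersurface.interval)) =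
          Z.realStructure E.twistI '' (D.P i s)) ∧
        ∀ {K : Type*} (ζ : K → Z.H Hypersurface.interval) (d s : K → ZMod 2),
          KreinSuperspace.IsOrthonormalBasis D ζ d s →
          KreinSuperspace.IsOrthonormalBasis D' (fun k => Z.realStructure E.twistI (ζ k)) d
            (fun k => s k + d k)) ∧
    -- there is a decomposition whose pieces are permuted by the real structure
    ∃ D : (Z.H Hypersurface.interval).Decomposition, ∀ i s : ZMod 2,
      Z.realStructure E.twistI '' (D.P i s) = D.P i (s + i) := by
  have hα := Z.isRealStructure E hZ hD
  have happ : ⇑(Z.realStructureEquiv E.twistI E.twistI_twistI) = Z.realStructure E.twistI :=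
    funext (Z.realStructureEquiv_apply E.twistI E.twistI_twistI)
  refine ⟨Z.form_eq_disk E hD E.fII, fun i j ψ hψ η hη => ⟨?_, ?_⟩, fun D => ?_, ?_⟩
  · rw [← happ]
    exact hα.form_deg i j ψ hψ η hη
  · rw [KreinSuperspace.form_conj]
  · refine ⟨hα.mapDecomposition D, fun i s => ?_, fun {K} ζ d s h => ?_⟩
    · rw [← happ]
      conv_rhs => rw [← zmod_two_add_add s i]
      rfl
    · rw [← happ]
      exact hα.map_isOrthonormalBasis h
  · rw [← happ]
    exact hα.exists_decomposition
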